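/- The sixth Painlevé equation for the tuple $(\hat\theta_0,\hat\theta_1,\hat\theta_t,\hat\theta_\infty)\in\mathbb C^4$ is $$y''=\tfrac12\Big(\tfrac1y+\tfrac1{y-1}+\tfrac1{y-t}\Big)(y')^2-\Big(\tfrac1t+\tfrac1{t-1}+\tfrac1{y-t}\Big)y'+\frac{y(y-1)(y-t)}{t^2(t-1)^2}\Big(\alpha+\beta\frac t{y^2}+\gamma\frac{t-1}{(y-1)^2}+\delta\frac{t(t-1)}{(y-t)^2}\Big),$$ with $\alpha=\frac{(\hat\theta_\infty-1)^2}2$, $\beta=-\frac{\hat\theta_0^2}2$, $\gamma=\frac{\hat\theta_1^2}2$, $\delta=\frac{1-\hat\theta_t^2}2$. Let $U\subset\mathbb C\setminus\{0,1\}$ be an open set of values of $t_0$. For $t_0\in U$ let $z=z(z_1)$ be a quadratic Belyi function: a rational function of degree two whose two critical values form a two-element subset $P$ of $\{0,1,t_0,\infty\}$; the same pair of labels is taken for all $t_0\in U$, and $z$ may depend on $t_0$. The four preimages of the two points of $\{0,1,t_0,\infty\}\setminus P$ are called non-apparent. Let $\tilde z$ be a fractional linear transformation (depending on $t_0$) which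 maps the set of non-apparent points onto a set $\{0,1,t,\infty\}$, $t\ne0,1$; let $\tau$ be the non-apparent point with $\tilde z(\tau)\notin\{0,1,\infty\}$, and put $$t=T(t_0)=\tilde z(\tau),\qquad i_k=z(\tilde z^{-1}(k))\in\{0,1,t_0,\infty\},\quad k=0,1,t,\infty,$$ where $T$ is holomorphic on $U$ and the labels $i_k$ are the same for all $t_0\in U$. Let $y_0(t_0)$ be a meromorphic solution on $U$ of the sixth Painlevé equation with independent variable $t_0$ and a tuple $(\hat\theta^0_k)$ such that, for $k\in P$, $\hat\theta^0_k=0$ if $k\in\{0,1,t_0\}$ and $\hat\theta^0_k=1$ if $k=\infty$; the other two members are arbitrary complex numbers. Here a meromorphic solution is one for which the equation makes sense and holds off a discrete set; in particular it is not identically $0$, $1$ or the independent variable on any component. 1. The derivative of $T$ does not vanish on $U$, and every meromorphic branch of $$y(t)=\tilde z\big(z^{-1}(y_0(t_0))\big),\qquad t=T(t_0),$$ regarded as a function of $t$ on $T(W)$ for any open $W\subset U$ on which $T$ is injective, is a solution of the sixth Painlevé equation for the tuple $(\hat\theta_k)$ given by $$\hat\theta_k=\tfrac12\hat\theta^0_{i_k}\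 (k\ne\infty,\ i_k\ne\infty),\qquad \hat\theta_k=\tfrac12(\hat\theta^0_\infty-1)\ (k\ne\infty,\ i_k=\infty),$$ $$\hat\theta_\infty-1=\tfrac12\hat\theta^0_{i_\infty}\ (i_\infty\ne\infty),\qquad \hat\theta_\infty-1=\tfrac12(\hat\theta^0_\infty-1)\ (i_\infty=\infty).$$ 2. For each $t_0\in\mathbb C\setminus\{0,1\}$ and each of the six two-element subsets $P$ of $\{0,1,t_0,\infty\}$ there is a quadratic Belyi function with critical values $P$, unique up to a fractional linear change of $z_1$; for each such function there are exactly $24$ admissible $\tilde z$. So, one function being chosen for each $P$, there are exactly $6\cdot24=144$ pairs $(z,\tilde z)$. 3. Manin's transformation is among them: if $r$ is a holomorphic branch of $\sqrt{t_0^2-t_0}$ on $U$, then $$z=\frac{z_1^2}{4(z_1-1)},\quad \tilde z(z_1)=\frac{z_1-2t_0+2r}{1-2t_0+2r},\quad \tau=2(t_0+r),\quad t=\frac{4r}{1-2t_0+2r}$$ are data as above with $P=\{0,1\}$ and $(i_0,i_1,i_t,i_\infty)=(t_0,\infty,t_0,\infty)$. For every meromorphic solution $y_0$ with tuple $(0,0,\hat\theta^0_{t_0},\hat\theta^0_\infty)$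 and every meromorphic branch $\rho$ of $\sqrt{y_0^2-y_0}$ on $U$, the function $y=\frac{2(y_0+\rho-t_0+r)}{1-2t_0+2r}$ is a branch of $\tilde z(z^{-1}(y_0))$, and as a function of $t$ it is a solution (in the sense of 1) for the tuple $\big(\tfrac12\hat\theta^0_{t_0},\tfrac12(\hat\theta^0_\infty-1),\tfrac12\hat\theta^0_{t_0},1+\tfrac12(\hat\theta^0_\infty-1)\big)$. -/

import Mathlib

open Polynomial

namespace PainleveSix

/-- Labels of the four singular points `0`, `1`, `t`, `∞` of the sixth Painlevé equation. -/
inductive Sing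
  | zero
  | one
  | t
  | infty
  deriving DecidableEq

instance : Fintype Sing where
  elems := {.zero, .one, .t, .infty}
  complete := by intro k; cases k <;> simp

/-- The point of the Riemann sphere carrying a given label, when the moving point is at `t`. -/
def Sing.point (t : ℂ) : Sing → OnePoint ℂ
  | .zero => ((0 : ℂ) : OnePoint ℂ)
  | .one => ((1 : ℂ) : OnePoint ℂ)
  | .t => (t : OnePoint ℂ)
  | .infty => OnePoint.infty

/-- Right-hand side of the sixth Painlevé equation, `y'' = rhs`, with coefficients
`α, β, γ, δ`; here `p` stands for `y'`. -/
noncomputable def rhs (α β γ δ t y p : ℂ) : ℂ :=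
  1 / 2 * (1 / y + 1 / (y - 1) + 1 / (y - t)) * p ^ 2
    - (1 / t + 1 / (t - 1) + 1 / (y - t)) * p
    + y * (y - 1) * (y - t) / (t ^ 2 * (t - 1) ^ 2)
      * (α + β * (t / y ^ 2) + γ * ((t - 1) / (y - 1) ^ 2)
          + δ * (t * (t - 1) / (y - t) ^ 2))

/-- `y` is a meromorphic solution, on the open set `U ⊆ ℂ ∖ {0, 1}`, of the sixth Painlevé
equation with `α = (θ_∞ - 1)² / 2`, `β = - θ_0² / 2`, `γ = θ_1² / 2`, `δ = (1 - θ_t²) / 2`.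
The equation is required off a discrete subset of `U`, which has to contain the poles of `y` and
the points where `y` takes one of the values `0`, `1`, `t`; so `y` is on no component of `U` one
of the functions `0`, `1`, `t`, for which the equation makes no sense. -/
def IsSolution (θ : Sing → ℂ) (U : Set ℂ) (y : ℂ → ℂ) : Prop :=
  IsOpen U ∧ (0 : ℂ) ∉ U ∧ (1 : ℂ) ∉ U ∧ MeromorphicOn y U ∧
    ∀ᶠ t in Filter.codiscreteWithin U,
      AnalyticAt ℂ y t ∧ y t ≠ 0 ∧ y t ≠ 1 ∧ y t ≠ t ∧
      deriv (deriv y) t =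
        rhs ((θ .infty - 1) ^ 2 / 2) (-(θ .zero) ^ 2 / 2) ((θ .one) ^ 2 / 2)
          ((1 - (θ .t) ^ 2) / 2) t (y t) (deriv y t)

/-- The self-map of the Riemann sphere given by `p / q`, for coprime polynomials `p`, `q` with
`max (deg p) (deg q) = 2`. -/
noncomputable def quadraticMap (p q : ℂ[X]) : OnePoint ℂ → OnePoint ℂ
  | OnePoint.infty =>
      if q.coeff 2 = 0 then OnePoint.infty else ((p.coeff 2 / q.coeff 2 : ℂ) : OnePoint ℂ)
  | OnePoint.some x =>
      if q.eval x = 0 then OnePoint.infty else ((p.eval x / q.eval x : ℂ) : OnePoint ℂ)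

/-- `f` is a rational function of degree two. -/
def IsQuadratic (f : OnePoint ℂ → OnePoint ℂ) : Prop :=
  ∃ p q : ℂ[X], IsCoprime p q ∧ max p.natDegree q.natDegree = 2 ∧ f = quadraticMap p q

/-- `z` is a quadratic Belyi function with critical values in `{0, 1, t₀, ∞}`, of the following
type: the box of each label in the two-element set `P` is `2` (a single, double, preimage), and
the box of each of the other two labels is `1+1` (two simple preimages). -/
def IsQuadraticBelyi (t₀ : ℂ) (P : Finset Sing) (z : OnePoint ℂ → OnePoint ℂ) : Prop :=
  IsQuadratic z ∧ P.card = 2 ∧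
    (∀ k ∈ P, (z ⁻¹' {k.point t₀}).ncard = 1) ∧
    (∀ k ∉ P, (z ⁻¹' {k.point t₀}).ncard = 2)

/-- The set of non-apparent preimages: the preimages of the points with boxes `1+1`. -/
def nonApparent (t₀ : ℂ) (P : Finset Sing) (z : OnePoint ℂ → OnePoint ℂ) :
    Set (OnePoint ℂ) :=
  {x | ∃ k : Sing, k ∉ P ∧ z x = k.point t₀}

/-- The fractional linear transformations `f` that map the set of non-apparent preimages of `z`
onto a set of the form `{0, 1, t, ∞}`, with some `t ≠ 0, 1`. -/
def IsNormalizing (t₀ : ℂ) (P : Finset Sing) (z f : OnePoint ℂ → OnePoint ℂ) : Prop :=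
  (∃ g : Matrix.GeneralLinearGroup (Fin 2) ℂ, f = fun x => g • x) ∧
    ∃ t : ℂ, t ≠ 0 ∧ t ≠ 1 ∧ f '' nonApparent t₀ P z = Set.range (Sing.point t)

/-- The data of a quadratic transformation over the open set `U` of values of `t₀`: quadratic
Belyi functions `z t₀` with critical values labelled by `P`; fractional linear transformations
`m t₀` (the map `z̃`) sending the non-apparent preimages to `{0, 1, t, ∞}`; the non-apparent point
`τ t₀` with `z̃ (τ) ∉ {0, 1, ∞}`; the holomorphic function `T t₀ = z̃ (τ)`, a branch of the new
independent variable `t`; and the labels `i k` with `i_k = z (z̃⁻¹ (k))`. -/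
structure IsTransformation (U : Set ℂ) (P : Finset Sing) (z : ℂ → OnePoint ℂ → OnePoint ℂ)
    (m : ℂ → Matrix.GeneralLinearGroup (Fin 2) ℂ) (τ : ℂ → OnePoint ℂ) (T : ℂ → ℂ)
    (i : Sing → Sing) : Prop where
  isOpen : IsOpen U
  zero_notMem : (0 : ℂ) ∉ U
  one_notMem : (1 : ℂ) ∉ U
  belyi : ∀ t₀ ∈ U, IsQuadraticBelyi t₀ P (z t₀)
  normalizing : ∀ t₀ ∈ U, IsNormalizing t₀ P (z t₀) (fun x => m t₀ • x)
  mem_nonApparent : ∀ t₀ ∈ U, τ t₀ ∈ nonApparent t₀ P (z t₀)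
  holomorphic : DifferentiableOn ℂ T U
  smul_tau : ∀ t₀ ∈ U, m t₀ • τ t₀ = (T t₀ : OnePoint ℂ) ∧ T t₀ ≠ 0 ∧ T t₀ ≠ 1
  label : ∀ t₀ ∈ U, ∀ k : Sing, z t₀ ((m t₀)⁻¹ • k.point (T t₀)) = (i k).point t₀

/-- The condition on the initial parameters: `θ⁰_k` vanishes for the labels `k ≠ ∞` with box `2`,
and `θ⁰_∞ = 1` if the box of `∞` is `2`. -/
def Admissible (P : Finset Sing) (θ₀ : Sing → ℂ) : Prop :=
  ∀ k ∈ P, θ₀ k = if k = .infty then 1 else 0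

/-- The new parameters: half of `θ⁰` at `i_k`, where the parameters attached to `∞` on either
side enter through `θ_∞ - 1`. -/
noncomputable def newTheta (θ₀ : Sing → ℂ) (i : Sing → Sing) (k : Sing) : ℂ :=
  (if k = .infty then 1 else 0) +
    (if i k = .infty then (θ₀ .infty - 1) / 2 else θ₀ (i k) / 2)

/-- `Y` is a meromorphic branch over `U` of the function `t₀ ↦ z̃ (z⁻¹ (y₀ (t₀)))`. -/
def IsBranch (U : Set ℂ) (z : ℂ → OnePoint ℂ → OnePoint ℂ)
    (m : ℂ → Matrix.GeneralLinearGroup (Fin 2) ℂ) (y₀ Y : ℂ → ℂ) : Prop :=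
  MeromorphicOn Y U ∧
    ∀ᶠ t₀ in Filter.codiscreteWithin U,
      ∃ w : OnePoint ℂ, z t₀ w = (y₀ t₀ : OnePoint ℂ) ∧ m t₀ • w = (Y t₀ : OnePoint ℂ)

/-- The function `y` of `t` given parametrically by `t = T t₀`, `y = Y t₀`, `t₀ ∈ U`, is well
defined near each point and solves the sixth Painlevé equation with parameters `θ`: the
change of variable `T` has no critical point, and `Y ∘ T⁻¹` is a solution on `T(W)` for every
open `W ⊆ U` on which `T` is injective. -/
def SolvesParametrically (θ : Sing → ℂ) (U : Set ℂ) (T Y : ℂ → ℂ) : Prop :=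
  (∀ t₀ ∈ U, deriv T t₀ ≠ 0) ∧
    ∀ W ⊆ U, IsOpen W → Set.InjOn T W →
      ∀ y : ℂ → ℂ, (∀ t₀ ∈ W, y (T t₀) = Y t₀) → IsSolution θ (T '' W) y

/-- The labels `i_0 = t₀`, `i_1 = ∞`, `i_t = t₀`, `i_∞ = ∞` of Manin's transformation. -/
def maninLabel : Sing → Sing
  | .zero => .t
  | .one => .infty
  | .t => .t
  | .infty => .infty

/-- The tuple `(θ_t / 2, (θ_∞ - 1) / 2, θ_t / 2, 1 + (θ_∞ - 1) / 2)` of parameters at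
`0, 1, t, ∞` which Manin's transformation produces from `(0, 0, θ_t, θ_∞)`. -/
noncomputable def maninTheta (θ₀ : Sing → ℂ) : Sing → ℂ
  | .zero => θ₀ .t / 2
  | .one => (θ₀ .infty - 1) / 2
  | .t => θ₀ .t / 2
  | .infty => 1 + (θ₀ .infty - 1) / 2

end PainleveSix

namespace PainleveSix
open Filter Topology

/-! The equation depends only on the squares of `θ_0`, `θ_1`, `θ_t`, `θ_∞ - 1`, and halving the
parameters divides these squares by four. In these terms it is covariant under the group S₄ of
permutations of the four singular points, acting by fractional linear changes of `y` together with
the induced changes of `t`. The equation is studied along parametrised curves `(T, Y)`, through a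
polynomial-type `defect` in their 2-jets. Each of the substitutions `1 - y`, `1 / y`, `t / y`
multiplies the defect by a nonvanishing factor, and they generate S₄ (`exists_isSymmetry`).

A rational function of degree two is the squaring map up to fractional linear maps on both sides, as
soon as two of its values have single preimages (`IsQuadratic.exists_eq_smul_sphereSq`). Applying
symmetries in the source and in the target moves the critical values to `0, 1` and the labels to
`maninLabel`. What remains is a one-parameter normal form (`IsLabelled.exists_landen`): for some `A
≠ 0`, s = (A + 1)² / (4A), T = 1 - A², y₀ = -(Y - 1 - A)² / (4A(Y - 1)). For this substitution
`defect_quadratic` is a single rational identity between the two defects.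

No regularity of `z` or `z̃` in `t₀` is assumed, so `A` is first found separately for each `t₀`.
Since `A = (2 - T) / (2(2s - 1))`, it is analytic wherever `s ≠ 1/2`. These exceptional points are
isolated and harmless for a meromorphic solution. The derivative of `T` must be controlled there
too, and this is done by expanding (2 - T)² = 4(2s - 1)²(1 - T) to second order.

The counts come from sharp 3-transitivity of the fractional linear group: an admissible `z̃` amounts
to an injection of `{0, 1, ∞}` into the four non-apparent points, giving 4·3·2 = 24, and there are
six pairs of critical values. Manin's transformation is an explicit instance of the general data. -/

/-! ### Covariance identities for the defect of the equation -/

/-- The right-hand side of the sixth Painlevé equation in terms of the squares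
`θ_0²`, `θ_1²`, `θ_t²`, `(θ_∞ - 1)²` of the shifted parameters. -/
noncomputable def rhsSq (e : Sing → ℂ) (t y p : ℂ) : ℂ :=
  rhs (e .infty / 2) (-(e .zero) / 2) (e .one / 2) ((1 - e .t) / 2) t y p

/-- The defect in the sixth Painlevé equation of a parametrised curve with 2-jets
`(T, T₁, T₂)` and `(Y, Y₁, Y₂)`. -/
noncomputable def defect (e : Sing → ℂ) (T T₁ T₂ Y Y₁ Y₂ : ℂ) : ℂ :=
  Y₂ * T₁ - Y₁ * T₂ - T₁ ^ 3 * rhsSq e T Y (Y₁ / T₁)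

/-- The powers of `T₁` cancel the quotient `Y₁ / T₁`, and each of the four parameters multiplies a
rational term of its own. In this shape the identities below are within reach of `field_simp` and
`ring`. -/
lemma rhsSq_mul (e : Sing → ℂ) {T T₁ Y Y₁ : ℂ} (hT : T ≠ 0) (hT1 : T - 1 ≠ 0) (hT₁ : T₁ ≠ 0)
    (hY : Y ≠ 0) (hY1 : Y - 1 ≠ 0) (hYT : Y - T ≠ 0) :
    T₁ ^ 3 * rhsSq e T Y (Y₁ / T₁) =
      1 / 2 * (1 / Y + 1 / (Y - 1) + 1 / (Y - T)) * Y₁ ^ 2 * T₁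
        - (1 / T + 1 / (T - 1) + 1 / (Y - T)) * Y₁ * T₁ ^ 2
        + T₁ ^ 3 / (2 * T ^ 2 * (T - 1) ^ 2) * (e .infty * (Y * (Y - 1) * (Y - T))
          - e .zero * (T * (Y - 1) * (Y - T) / Y) + e .one * ((T - 1) * Y * (Y - T) / (Y - 1))
          + (1 - e .t) * (T * (T - 1) * Y * (Y - 1) / (Y - T))) := by
  simp only [rhsSq, rhs]
  field_simp
  ring

lemma defect_one_sub (e : Sing → ℂ) {T T₁ T₂ Y Y₁ Y₂ : ℂ} (hT : T ≠ 0) (hT1 : T - 1 ≠ 0)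
    (hT₁ : T₁ ≠ 0) (hY : Y ≠ 0) (hY1 : Y - 1 ≠ 0) (hYT : Y - T ≠ 0) :
    defect (e ∘ Equiv.swap .zero .one) (1 - T) (-T₁) (-T₂) (1 - Y) (-Y₁) (-Y₂) =
      defect e T T₁ T₂ Y Y₁ Y₂ := by
  have h1 : 1 - T ≠ 0 := by rw [← neg_sub]; exact neg_ne_zero.2 hT1
  have h2 : 1 - Y ≠ 0 := by rw [← neg_sub]; exact neg_ne_zero.2 hY1
  have h3 : 1 - T - 1 = -T := by ring
  have h4 : 1 - Y - 1 = -Y := by ring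
  have h5 : 1 - Y - (1 - T) = -(Y - T) := by ring
  rw [defect, defect, rhsSq_mul e hT hT1 hT₁ hY hY1 hYT, rhsSq_mul _ h1 (by simpa [h3]) (by simpa)
    h2 (by simpa [h4]) (by rw [h5]; exact neg_ne_zero.2 hYT)]
  have e1 : (e ∘ Equiv.swap Sing.zero .one) .zero = e .one := by simp
  have e2 : (e ∘ Equiv.swap Sing.zero .one) .one = e .zero := by simp
  have e3 : (e ∘ Equiv.swap Sing.zero .one) .t = e .t := by
    simp [Equiv.swap_apply_of_ne_of_ne]
  have e4 : (e ∘ Equiv.swap Sing.zero .one) .infty = e .infty := by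
    simp [Equiv.swap_apply_of_ne_of_ne]
  rw [e1, e2, e3, e4, h3, h4, h5, ← neg_sub T 1, ← neg_sub Y 1]
  field_simp
  ring

/-- The arguments on the left are the 2-jets of `1 / T` and `1 / Y`. Only the vanishing of the
defect matters later, so a nonzero factor is allowed. -/
lemma defect_inv (e : Sing → ℂ) {T T₁ T₂ Y Y₁ Y₂ : ℂ} (hT : T ≠ 0) (hT1 : T - 1 ≠ 0)
    (hT₁ : T₁ ≠ 0) (hY : Y ≠ 0) (hY1 : Y - 1 ≠ 0) (hYT : Y - T ≠ 0) :
    defect (e ∘ Equiv.swap .zero .infty) (1 / T) (-T₁ / T ^ 2) (-T₂ / T ^ 2 + 2 * T₁ ^ 2 / T ^ 3)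
        (1 / Y) (-Y₁ / Y ^ 2) (-Y₂ / Y ^ 2 + 2 * Y₁ ^ 2 / Y ^ 3) =
      1 / (Y ^ 2 * T ^ 2) * defect e T T₁ T₂ Y Y₁ Y₂ := by
  have h3 : 1 / T - 1 = -(T - 1) / T := by field_simp; ring
  have h4 : 1 / Y - 1 = -(Y - 1) / Y := by field_simp; ring
  have h5 : 1 / Y - 1 / T = -(Y - T) / (T * Y) := by field_simp; ring
  rw [defect, defect, rhsSq_mul e hT hT1 hT₁ hY hY1 hYT, rhsSq_mul _ (by simpa)
    (by rw [h3]; exact div_ne_zero (neg_ne_zero.2 hT1) hT) (by simp [*]) (by simpa)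
    (by rw [h4]; exact div_ne_zero (neg_ne_zero.2 hY1) hY)
    (by rw [h5]; exact div_ne_zero (neg_ne_zero.2 hYT) (mul_ne_zero hT hY))]
  have e1 : (e ∘ Equiv.swap Sing.zero .infty) .zero = e .infty := by simp
  have e2 : (e ∘ Equiv.swap Sing.zero .infty) .one = e .one := by
    simp [Equiv.swap_apply_of_ne_of_ne]
  have e3 : (e ∘ Equiv.swap Sing.zero .infty) .t = e .t := by
    simp [Equiv.swap_apply_of_ne_of_ne]
  have e4 : (e ∘ Equiv.swap Sing.zero .infty) .infty = e .zero := by simp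
  rw [e1, e2, e3, e4, h3, h4, h5]
  field_simp
  ring

/-- This generator fixes the independent variable: `y ↦ t / y` realises a double transposition of
the singular points. The last arguments are the 2-jet of `T / Y`. -/
lemma defect_div (e : Sing → ℂ) {T T₁ T₂ Y Y₁ Y₂ : ℂ} (hT : T ≠ 0) (hT1 : T - 1 ≠ 0)
    (hT₁ : T₁ ≠ 0) (hY : Y ≠ 0) (hY1 : Y - 1 ≠ 0) (hYT : Y - T ≠ 0) :
    defect (e ∘ (Equiv.swap Sing.zero .infty * Equiv.swap Sing.one .t)) T T₁ T₂
        (T / Y) (T₁ / Y - T * Y₁ / Y ^ 2)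
        (T₂ / Y - 2 * T₁ * Y₁ / Y ^ 2 - T * Y₂ / Y ^ 2 + 2 * T * Y₁ ^ 2 / Y ^ 3) =
      -T / Y ^ 2 * defect e T T₁ T₂ Y Y₁ Y₂ := by
  have h4 : T / Y - 1 = -(Y - T) / Y := by field_simp; ring
  have h5 : T / Y - T = -T * (Y - 1) / Y := by field_simp; ring
  rw [defect, defect, rhsSq_mul e hT hT1 hT₁ hY hY1 hYT, rhsSq_mul _ hT hT1 hT₁
    (by simp [*]) (by rw [h4]; exact div_ne_zero (neg_ne_zero.2 hYT) hY)
    (by rw [h5]; exact div_ne_zero (mul_ne_zero (neg_ne_zero.2 hT) hY1) hY)]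
  have e1 : (e ∘ (Equiv.swap Sing.zero .infty * Equiv.swap Sing.one .t)) .zero = e .infty := by
    simp [Equiv.swap_apply_of_ne_of_ne]
  have e2 : (e ∘ (Equiv.swap Sing.zero .infty * Equiv.swap Sing.one .t)) .one = e .t := by
    simp [Equiv.swap_apply_of_ne_of_ne]
  have e3 : (e ∘ (Equiv.swap Sing.zero .infty * Equiv.swap Sing.one .t)) .t = e .one := by
    simp [Equiv.swap_apply_of_ne_of_ne]
  have e4 : (e ∘ (Equiv.swap Sing.zero .infty * Equiv.swap Sing.one .t)) .infty = e .zero := by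
    simp [Equiv.swap_apply_of_ne_of_ne]
  rw [e1, e2, e3, e4, h4, h5]
  field_simp
  ring

-- The computational core. With `a = A` and `v = Y - 1`, the left side carries the 2-jets of `s` and
-- `y₀` in the normal form, and the right side those of `T` and `Y`. Vanishing of `e .zero` and `e
-- .one` is essential: their terms would have poles at `v = a` and `v = -a`, the critical points of
-- the quadratic map, which nothing on the right could match.
set_option maxRecDepth 4000 in
lemma defect_quadratic (e : Sing → ℂ) {a a₁ a₂ v v₁ v₂ : ℂ} (h0 : e .zero = 0) (h1 : e .one = 0)
    (ha : a ≠ 0) (ham : a - 1 ≠ 0) (hap : a + 1 ≠ 0) (ha₁ : a₁ ≠ 0)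
    (hv : v ≠ 0) (hv1 : v + 1 ≠ 0) (hva : v + a ^ 2 ≠ 0) (hvm : v - a ≠ 0) (hvp : v + a ≠ 0) :
    defect e ((a + 1) ^ 2 / (4 * a)) ((a - 1) * (a + 1) / (4 * a ^ 2) * a₁)
        ((a - 1) * (a + 1) / (4 * a ^ 2) * a₂ + a₁ ^ 2 / (2 * a ^ 3))
        (-(v - a) ^ 2 / (4 * a * v))
        (-(v₁ / a - v * a₁ / a ^ 2 + a₁ / v - a * v₁ / v ^ 2) / 4)
        (-(v₂ / a - 2 * v₁ * a₁ / a ^ 2 - v * a₂ / a ^ 2 + 2 * v * a₁ ^ 2 / a ^ 3 + a₂ / v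
          - 2 * a₁ * v₁ / v ^ 2 - a * v₂ / v ^ 2 + 2 * a * v₁ ^ 2 / v ^ 3) / 4) =
      (v - a) * (v + a) * (a - 1) * (a + 1) / (32 * a ^ 4 * v ^ 2) *
        defect (fun k => e (maninLabel k) / 4) (1 - a ^ 2) (-2 * a * a₁) (-2 * a₁ ^ 2 - 2 * a * a₂)
          (v + 1) v₁ v₂ := by
  have hT : 1 - a ^ 2 = -((a - 1) * (a + 1)) := by ring
  have hT1 : 1 - a ^ 2 - 1 = - a ^ 2 := by ring
  have hY1 : v + 1 - 1 = v := by ring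
  have hYT : v + 1 - (1 - a ^ 2) = v + a ^ 2 := by ring
  have hs1 : (a + 1) ^ 2 / (4 * a) - 1 = (a - 1) ^ 2 / (4 * a) := by field_simp; ring
  have hy1 : -(v - a) ^ 2 / (4 * a * v) - 1 = -(v + a) ^ 2 / (4 * a * v) := by field_simp; ring
  have hys : -(v - a) ^ 2 / (4 * a * v) - (a + 1) ^ 2 / (4 * a) =
    -(v + 1) * (v + a ^ 2) / (4 * a * v) := by field_simp; ring
  rw [defect, defect, rhsSq_mul _ (by simp [*]) (by rw [hs1]; simp [*]) (by simp [*])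
    (by simp [*]) (by rw [hy1]; simp [*])
    (by rw [hys]; apply div_ne_zero (mul_ne_zero (neg_ne_zero.2 hv1) hva); simp [*]),
    rhsSq_mul _ (by rw [hT]; simp [*]) (by rw [hT1]; simp [*]) (by simp [*]) hv1
      (by rwa [hY1]) (by rwa [hYT])]
  rw [hT1, hY1, hYT, hs1, hy1, hys, hT]
  simp only [h0, h1, maninLabel]
  field_simp
  ring

/-! ### Two-jets and regular points -/

lemma deriv_deriv_eq {f f' : ℂ → ℂ} {x c : ℂ} (h : ∀ᶠ u in 𝓝 x, HasDerivAt f (f' u) u)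
    (h' : HasDerivAt f' c x) : deriv f x = f' x ∧ deriv (deriv f) x = c := by
  refine ⟨h.self_of_nhds.deriv, ?_⟩
  have : deriv f =ᶠ[𝓝 x] f' := h.mono fun u hu => hu.deriv
  rw [this.deriv_eq, h'.deriv]

lemma eventually_hasDerivAt {f : ℂ → ℂ} {x : ℂ} (hf : AnalyticAt ℂ f x) :
    ∀ᶠ u in 𝓝 x, HasDerivAt f (deriv f u) u :=
  hf.eventually_analyticAt.mono fun _ hu => hu.differentiableAt.hasDerivAt

/-- `T` and `Y` are analytic at `x`, `T` is unramified there, and the values avoid the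
singularities of the sixth Painlevé equation. -/
structure RegularAt (T Y : ℂ → ℂ) (x : ℂ) : Prop where
  analytic_left : AnalyticAt ℂ T x
  analytic_right : AnalyticAt ℂ Y x
  deriv_ne : deriv T x ≠ 0
  left_ne_zero : T x ≠ 0
  left_ne_one : T x ≠ 1
  ne_point : ∀ k : Sing, (Y x : OnePoint ℂ) ≠ k.point (T x)

/-- The parametrised curve `(T, Y)` satisfies the sixth Painlevé equation at `x`. -/
def SolvesAt (e : Sing → ℂ) (T Y : ℂ → ℂ) (x : ℂ) : Prop :=
  defect e (T x) (deriv T x) (deriv (deriv T) x) (Y x) (deriv Y x) (deriv (deriv Y) x) = 0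

lemma forall_ne_point_iff {T Y : ℂ} :
    (∀ k : Sing, (Y : OnePoint ℂ) ≠ k.point T) ↔ Y ≠ 0 ∧ Y ≠ 1 ∧ Y ≠ T := by
  constructor
  · intro h
    refine ⟨fun h' => h .zero ?_, fun h' => h .one ?_, fun h' => h .t ?_⟩ <;> rw [h'] <;> rfl
  · rintro ⟨h0, h1, h2⟩ (_ | _ | _ | _)
    · simpa [Sing.point, OnePoint.coe_eq_coe] using h0
    · simpa [Sing.point, OnePoint.coe_eq_coe] using h1
    · simpa [Sing.point, OnePoint.coe_eq_coe] using h2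
    · exact OnePoint.coe_ne_infty _

lemma point_injective {t : ℂ} (h0 : t ≠ 0) (h1 : t ≠ 1) : Function.Injective (Sing.point t) := by
  intro j k h
  cases j <;> cases k <;>
    simp_all [Sing.point, OnePoint.infty_ne_coe, eq_comm]

lemma jet_inv {f : ℂ → ℂ} {x : ℂ} (hf : AnalyticAt ℂ f x) (h0 : f x ≠ 0) :
    deriv (fun u => 1 / f u) x = -deriv f x / f x ^ 2 ∧
      deriv (deriv fun u => 1 / f u) x =
        -deriv (deriv f) x / f x ^ 2 + 2 * deriv f x ^ 2 / f x ^ 3 := by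
  apply deriv_deriv_eq (f' := fun u => -deriv f u / f u ^ 2)
  · filter_upwards [eventually_hasDerivAt hf, hf.continuousAt.eventually_ne h0] with u hu hu0
    exact ((hasDerivAt_const u (1 : ℂ)).div hu hu0).congr_deriv (by simp)
  · have hd := hf.deriv.differentiableAt.hasDerivAt
    have hf' := hf.differentiableAt.hasDerivAt
    refine (hd.neg.div (hf'.pow 2) (pow_ne_zero 2 h0)).congr_deriv ?_
    simp only [Pi.neg_apply, Pi.pow_apply]
    field_simp
    ring

lemma jet_div {T Y : ℂ → ℂ} {x : ℂ} (hT : AnalyticAt ℂ T x) (hY : AnalyticAt ℂ Y x)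
    (h0 : Y x ≠ 0) :
    deriv (fun u => T u / Y u) x = deriv T x / Y x - T x * deriv Y x / Y x ^ 2 ∧
      deriv (deriv fun u => T u / Y u) x =
        deriv (deriv T) x / Y x - 2 * deriv T x * deriv Y x / Y x ^ 2
          - T x * deriv (deriv Y) x / Y x ^ 2 + 2 * T x * deriv Y x ^ 2 / Y x ^ 3 := by
  apply deriv_deriv_eq (f' := fun u => deriv T u / Y u - T u * deriv Y u / Y u ^ 2)
  · filter_upwards [eventually_hasDerivAt hT, eventually_hasDerivAt hY,
      hY.continuousAt.eventually_ne h0] with u hu hv hu0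
    refine (hu.div hv hu0).congr_deriv ?_
    field_simp
  · have hT' := hT.differentiableAt.hasDerivAt
    have hY' := hY.differentiableAt.hasDerivAt
    have hT2 := hT.deriv.differentiableAt.hasDerivAt
    have hY2 := hY.deriv.differentiableAt.hasDerivAt
    refine ((hT2.div hY' h0).sub
      ((hT'.mul hY2).div (hY'.pow 2) (pow_ne_zero 2 h0))).congr_deriv ?_
    simp only [Pi.mul_apply, Pi.pow_apply]
    field_simp
    ring

lemma jet_one_sub (f : ℂ → ℂ) (x : ℂ) :
    deriv (fun u => 1 - f u) x = -deriv f x ∧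
      deriv (deriv fun u => 1 - f u) x = -deriv (deriv f) x := by
  have : deriv (fun u => 1 - f u) = fun u => -deriv f u := by
    funext u
    rw [deriv_const_sub]
  refine ⟨by rw [this], ?_⟩
  rw [this, deriv.fun_neg]

/-! ### The symmetric group on the four singular points -/

/-- A family of fractional linear transformations `M T`, with `M T • Y = ν T Y`, which carries the
points `0, 1, T, ∞` to a permutation of `0, 1, μ T, ∞`, and under which the sixth Painlevé
equation is covariant. -/
structure IsSymmetry (σ : Equiv.Perm Sing) (μ : ℂ → ℂ) (ν : ℂ → ℂ → ℂ)
    (M : ℂ → Matrix.GeneralLinearGroup (Fin 2) ℂ) : Prop where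
  ne_zero : ∀ T, T ≠ 0 → T ≠ 1 → μ T ≠ 0
  ne_one : ∀ T, T ≠ 0 → T ≠ 1 → μ T ≠ 1
  analyticAt : ∀ T, T ≠ 0 → T ≠ 1 → AnalyticAt ℂ μ T
  deriv_ne : ∀ T, T ≠ 0 → T ≠ 1 → deriv μ T ≠ 0
  smul_point : ∀ T, T ≠ 0 → T ≠ 1 → ∀ k : Sing, M T • k.point T = (σ k).point (μ T)
  smul_coe : ∀ T, T ≠ 0 → T ≠ 1 → ∀ Y : ℂ, (∀ k : Sing, (Y : OnePoint ℂ) ≠ k.point T) →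
    M T • (Y : OnePoint ℂ) = (ν T Y : OnePoint ℂ)
  analyticAt_right : ∀ T Y x, RegularAt T Y x → AnalyticAt ℂ (fun u => ν (T u) (Y u)) x
  solvesAt_iff : ∀ e T Y x, RegularAt T Y x →
    (SolvesAt (e ∘ σ.symm) (fun u => μ (T u)) (fun u => ν (T u) (Y u)) x ↔ SolvesAt e T Y x)

namespace IsSymmetry

variable {σ : Equiv.Perm Sing} {μ : ℂ → ℂ} {ν : ℂ → ℂ → ℂ}
  {M : ℂ → Matrix.GeneralLinearGroup (Fin 2) ℂ}

lemma ne_point (h : IsSymmetry σ μ ν M) {T Y : ℂ} (h0 : T ≠ 0) (h1 : T ≠ 1)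
    (hY : ∀ k : Sing, (Y : OnePoint ℂ) ≠ k.point T) (k : Sing) :
    (ν T Y : OnePoint ℂ) ≠ k.point (μ T) := by
  intro hk
  apply hY (σ.symm k)
  rw [← h.smul_coe T h0 h1 Y hY, ← σ.apply_symm_apply k, ← h.smul_point T h0 h1] at hk
  exact MulAction.injective _ hk

lemma regularAt (h : IsSymmetry σ μ ν M) {T Y : ℂ → ℂ} {x : ℂ} (hr : RegularAt T Y x) :
    RegularAt (fun u => μ (T u)) (fun u => ν (T u) (Y u)) x := by
  obtain ⟨hT, hY, hd, h0, h1, hp⟩ := hr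
  have hμ := h.analyticAt _ h0 h1
  refine ⟨hμ.comp hT, h.analyticAt_right T Y x ⟨hT, hY, hd, h0, h1, hp⟩, ?_, h.ne_zero _ h0 h1,
    h.ne_one _ h0 h1, h.ne_point h0 h1 hp⟩
  have := (hμ.differentiableAt.hasDerivAt.comp x hT.differentiableAt.hasDerivAt).deriv
  rw [Function.comp_def] at this
  rw [this]
  exact mul_ne_zero (h.deriv_ne _ h0 h1) hd

lemma one : IsSymmetry 1 id (fun _ Y => Y) (fun _ => 1) where
  ne_zero _ h _ := h
  ne_one _ _ h := h
  analyticAt _ _ _ := analyticAt_id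
  deriv_ne _ _ _ := by simp
  smul_point _ _ _ _ := by simp
  smul_coe _ _ _ _ _ := by simp
  analyticAt_right _ _ _ h := h.analytic_right
  solvesAt_iff _ _ _ _ _ := Iff.rfl

lemma mul {σ' : Equiv.Perm Sing} {μ' : ℂ → ℂ} {ν' : ℂ → ℂ → ℂ}
    {M' : ℂ → Matrix.GeneralLinearGroup (Fin 2) ℂ} (h' : IsSymmetry σ' μ' ν' M')
    (h : IsSymmetry σ μ ν M) :
    IsSymmetry (σ' * σ) (fun T => μ' (μ T)) (fun T Y => ν' (μ T) (ν T Y))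
      (fun T => M' (μ T) * M T) where
  ne_zero T h0 h1 := h'.ne_zero _ (h.ne_zero T h0 h1) (h.ne_one T h0 h1)
  ne_one T h0 h1 := h'.ne_one _ (h.ne_zero T h0 h1) (h.ne_one T h0 h1)
  analyticAt T h0 h1 :=
    (h'.analyticAt _ (h.ne_zero T h0 h1) (h.ne_one T h0 h1)).comp (h.analyticAt T h0 h1)
  deriv_ne T h0 h1 := by
    have a' := h'.analyticAt _ (h.ne_zero T h0 h1) (h.ne_one T h0 h1)
    have a := h.analyticAt T h0 h1
    have := (a'.differentiableAt.hasDerivAt.comp T a.differentiableAt.hasDerivAt).deriv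
    rw [Function.comp_def] at this
    rw [this]
    exact mul_ne_zero (h'.deriv_ne _ (h.ne_zero T h0 h1) (h.ne_one T h0 h1)) (h.deriv_ne T h0 h1)
  smul_point T h0 h1 k := by
    rw [mul_smul, h.smul_point T h0 h1, h'.smul_point _ (h.ne_zero T h0 h1) (h.ne_one T h0 h1)]
    rfl
  smul_coe T h0 h1 Y hY := by
    rw [mul_smul, h.smul_coe T h0 h1 Y hY, h'.smul_coe _ (h.ne_zero T h0 h1) (h.ne_one T h0 h1) _
      (h.ne_point h0 h1 hY)]
  analyticAt_right T Y x hr := h'.analyticAt_right _ _ x (h.regularAt hr)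
  solvesAt_iff e T Y x hr := by
    rw [← h.solvesAt_iff e T Y x hr, ← h'.solvesAt_iff _ _ _ x (h.regularAt hr)]
    rfl

end IsSymmetry

lemma isSymmetry_one_sub : IsSymmetry (Equiv.swap .zero .one) (fun T => 1 - T) (fun _ Y => 1 - Y)
    (fun _ => Matrix.GeneralLinearGroup.mkOfDetNeZero !![-1, 1; 0, 1] (by simp)) where
  ne_zero T _ h1 := sub_ne_zero.2 (Ne.symm h1)
  ne_one T h0 _ := by simpa
  analyticAt T _ _ := by fun_prop
  deriv_ne T _ _ := by simp
  smul_point T _ _ k := by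
    cases k <;>
    simp [Sing.point, OnePoint.smul_some_eq_ite, OnePoint.smul_infty_eq_ite,
      Matrix.GeneralLinearGroup.mkOfDetNeZero, Equiv.swap_apply_of_ne_of_ne]
    ring_nf
  smul_coe T _ _ Y _ := by
    simp [OnePoint.smul_some_eq_ite, Matrix.GeneralLinearGroup.mkOfDetNeZero]
    ring_nf
  analyticAt_right T Y x h := by
    have := h.analytic_right
    fun_prop
  solvesAt_iff e T Y x h := by
    obtain ⟨hY0, hY1, hYT⟩ := forall_ne_point_iff.1 h.ne_point
    rw [SolvesAt, SolvesAt, Equiv.symm_swap, (jet_one_sub T x).1, (jet_one_sub T x).2,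
      (jet_one_sub Y x).1, (jet_one_sub Y x).2, defect_one_sub e h.left_ne_zero
      (sub_ne_zero.2 h.left_ne_one) h.deriv_ne hY0 (sub_ne_zero.2 hY1) (sub_ne_zero.2 hYT)]

lemma isSymmetry_inv : IsSymmetry (Equiv.swap .zero .infty) (fun T => 1 / T) (fun _ Y => 1 / Y)
    (fun _ => Matrix.GeneralLinearGroup.mkOfDetNeZero !![0, 1; 1, 0] (by simp)) where
  ne_zero T h0 _ := by simpa
  ne_one T h0 h1 := by simpa
  analyticAt T h0 _ := analyticAt_const.div analyticAt_id h0
  deriv_ne T h0 _ := by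
    have := ((hasDerivAt_id T).inv h0).deriv
    simp_all
  smul_point T h0 _ k := by
    cases k <;>
    simp [Sing.point, OnePoint.smul_some_eq_ite, OnePoint.smul_infty_eq_ite,
      Matrix.GeneralLinearGroup.mkOfDetNeZero, Equiv.swap_apply_of_ne_of_ne, h0]
  smul_coe T _ _ Y hY := by
    have := (forall_ne_point_iff.1 hY).1
    simp [OnePoint.smul_some_eq_ite, Matrix.GeneralLinearGroup.mkOfDetNeZero, this]
  analyticAt_right T Y x h :=
    analyticAt_const.div h.analytic_right (forall_ne_point_iff.1 h.ne_point).1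
  solvesAt_iff e T Y x h := by
    obtain ⟨hY0, hY1, hYT⟩ := forall_ne_point_iff.1 h.ne_point
    obtain ⟨t1, t2⟩ := jet_inv h.analytic_left h.left_ne_zero
    obtain ⟨y1, y2⟩ := jet_inv h.analytic_right hY0
    rw [SolvesAt, SolvesAt, Equiv.symm_swap, t1, t2, y1, y2, defect_inv e h.left_ne_zero
      (sub_ne_zero.2 h.left_ne_one) h.deriv_ne hY0 (sub_ne_zero.2 hY1) (sub_ne_zero.2 hYT),
      mul_eq_zero_iff_left]
    have := h.left_ne_zero
    exact one_div_ne_zero (mul_ne_zero (pow_ne_zero 2 hY0) (pow_ne_zero 2 this))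

open Classical in
lemma isSymmetry_div : IsSymmetry (Equiv.swap .zero .infty * Equiv.swap .one .t) id
    (fun T Y => T / Y) (fun T => if h : T = 0 then 1 else
      Matrix.GeneralLinearGroup.mkOfDetNeZero !![0, T; 1, 0] (by simpa using h)) where
  ne_zero T h0 _ := h0
  ne_one T h0 h1 := h1
  analyticAt T h0 _ := analyticAt_id
  deriv_ne T h0 _ := by simp
  smul_point T h0 _ k := by
    cases k <;>
    simp [Sing.point, OnePoint.smul_some_eq_ite, OnePoint.smul_infty_eq_ite,
      Matrix.GeneralLinearGroup.mkOfDetNeZero, Equiv.swap_apply_of_ne_of_ne, h0]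
  smul_coe T h0 _ Y hY := by
    have := (forall_ne_point_iff.1 hY).1
    simp [OnePoint.smul_some_eq_ite, Matrix.GeneralLinearGroup.mkOfDetNeZero, this, h0]
  analyticAt_right T Y x h :=
    h.analytic_left.div h.analytic_right (forall_ne_point_iff.1 h.ne_point).1
  solvesAt_iff e T Y x h := by
    obtain ⟨hY0, hY1, hYT⟩ := forall_ne_point_iff.1 h.ne_point
    obtain ⟨y1, y2⟩ := jet_div h.analytic_left h.analytic_right hY0
    have hσ : (Equiv.swap Sing.zero .infty * Equiv.swap .one .t : Equiv.Perm Sing).symm =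
      Equiv.swap Sing.zero .infty * Equiv.swap .one .t := by decide
    rw [SolvesAt, SolvesAt, hσ]
    simp only [id]
    rw [y1, y2, defect_div e h.left_ne_zero
      (sub_ne_zero.2 h.left_ne_one) h.deriv_ne hY0 (sub_ne_zero.2 hY1) (sub_ne_zero.2 hYT),
      mul_eq_zero_iff_left]
    have := h.left_ne_zero
    exact div_ne_zero (neg_ne_zero.2 this) (pow_ne_zero 2 hY0)

/-- Symmetries compose, so it suffices to reach every transposition. Conjugation of the three
generators by one another yields all six. -/
lemma exists_isSymmetry (σ : Equiv.Perm Sing) : ∃ μ ν M, IsSymmetry σ μ ν M := by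
  have hmul : ∀ {σ τ : Equiv.Perm Sing}, (∃ μ ν M, IsSymmetry σ μ ν M) →
      (∃ μ ν M, IsSymmetry τ μ ν M) → ∃ μ ν M, IsSymmetry (σ * τ) μ ν M := by
    rintro σ τ ⟨_, _, _, h⟩ ⟨_, _, _, h'⟩
    exact ⟨_, _, _, h.mul h'⟩
  have h1 : ∃ μ ν M, IsSymmetry (Equiv.swap .zero .one) μ ν M := ⟨_, _, _, isSymmetry_one_sub⟩
  have h2 : ∃ μ ν M, IsSymmetry (Equiv.swap .zero .infty) μ ν M := ⟨_, _, _, isSymmetry_inv⟩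
  have h3 : ∃ μ ν M, IsSymmetry (Equiv.swap .zero .infty * Equiv.swap .one .t) μ ν M :=
    ⟨_, _, _, isSymmetry_div⟩
  have hconj : ∀ {σ τ ρ : Equiv.Perm Sing}, σ * τ * σ = ρ → (∃ μ ν M, IsSymmetry σ μ ν M) →
      (∃ μ ν M, IsSymmetry τ μ ν M) → ∃ μ ν M, IsSymmetry ρ μ ν M := by
    rintro σ τ _ rfl h h'
    exact hmul (hmul h h') h
  have h01 : ∃ μ ν M, IsSymmetry (Equiv.swap .one .infty) μ ν M :=
    hconj (by decide) h1 h2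
  have hti : ∃ μ ν M, IsSymmetry (Equiv.swap .t .infty) μ ν M :=
    hconj (by decide) h3 h1
  have h0t : ∃ μ ν M, IsSymmetry (Equiv.swap .zero .t) μ ν M :=
    hconj (by decide) h2 hti
  have h1t : ∃ μ ν M, IsSymmetry (Equiv.swap .one .t) μ ν M :=
    hconj (by decide) h1 h0t
  have hswap : ∀ x y : Sing, ∃ μ ν M, IsSymmetry (Equiv.swap x y) μ ν M := by
    intro x y
    cases x <;> cases y <;> first
      | assumption
      | (rw [Equiv.swap_comm]; assumption)
      | (rw [Equiv.swap_self]; exact ⟨_, _, _, IsSymmetry.one⟩)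
  induction σ using Equiv.Perm.swap_induction_on with
  | one => exact ⟨_, _, _, IsSymmetry.one⟩
  | swap_mul f x y _ hf => exact hmul (hswap x y) hf

/-! ### The quadratic transformation in normal form -/

/-- Differentiating the algebraic relation between `s` and `T` excludes `T' = 0` unless `s = 1/2`.
There `T = 2`, and the relation says to second order that T'² = 16 s'² (1 - T), whose right side is
nonzero. -/
lemma deriv_ne_zero_of_landen {s T : ℂ → ℂ} {x : ℂ} (hs : AnalyticAt ℂ s x)
    (hT : AnalyticAt ℂ T x) (hd : deriv s x ≠ 0) (h1 : T x ≠ 1)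
    (h : ∀ᶠ u in 𝓝 x, ∃ A : ℂ, A ≠ 0 ∧ s u = (A + 1) ^ 2 / (4 * A) ∧ T u = 1 - A ^ 2) :
    deriv T x ≠ 0 := by
  intro hT0
  have hs' := hs.differentiableAt.hasDerivAt
  have hT' := hT.differentiableAt.hasDerivAt
  rw [hT0] at hT'
  -- Elimination of `A`: 2 - T = 1 + A², 2s - 1 = (1 + A²) / (2A) and 1 - T = A².
  have hrel : ∀ᶠ u in 𝓝 x, (2 - T u) ^ 2 = 4 * (2 * s u - 1) ^ 2 * (1 - T u) := by
    filter_upwards [h] with u ⟨A, hA, h1, h2⟩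
    rw [h1, h2]
    field_simp
    ring
  have hx := hrel.self_of_nhds
  have hl : HasDerivAt (fun u => (2 - T u) ^ 2) 0 x := by
    exact ((hT'.const_sub 2).pow 2).congr_deriv (by simp)
  have hr := ((((hs'.const_mul 2).sub_const 1).pow 2).const_mul 4).mul (hT'.const_sub 1)
  have hE : (fun u => (2 - T u) ^ 2) =ᶠ[𝓝 x] fun u => 4 * (2 * s u - 1) ^ 2 * (1 - T u) := hrel
  have h0 := hl.unique (hE.hasDerivAt_iff.2 hr)
  simp only [Nat.cast_ofNat, Nat.add_one_sub_one, pow_one, neg_zero, mul_zero, add_zero,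
    zero_eq_mul, mul_eq_zero, OfNat.ofNat_ne_zero, false_or, hd, or_false] at h0
  have h1' : 1 - T x ≠ 0 := sub_ne_zero.2 (Ne.symm h1)
  have hσ : 2 * s x - 1 = 0 := by
    rcases h0 with h0 | h0
    · exact h0
    · exact absurd h0 h1'
  have hT2 : T x = 2 := by
    rw [hσ] at hx
    have : (2 - T x) = 0 := by simpa using hx
    exact (sub_eq_zero.1 this).symm
  -- At `s = 1/2`, `T = 2` the first-order terms are void. Dividing the relation by `(u - x)²` turns
  -- both sides into squared difference quotients.
  have sl1 := hasDerivAt_iff_tendsto_slope.1 hs'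
  have sl2 := hasDerivAt_iff_tendsto_slope.1 hT'
  have lim1 : Tendsto (fun u => slope T x u ^ 2) (𝓝[≠] x) (𝓝 (0 ^ 2)) := sl2.pow 2
  have lim2 : Tendsto (fun u => 16 * slope s x u ^ 2 * (1 - T u)) (𝓝[≠] x)
      (𝓝 (16 * deriv s x ^ 2 * (1 - T x))) :=
    ((sl1.pow 2).const_mul 16).mul
      ((tendsto_const_nhds.sub hT.continuousAt.tendsto).mono_left nhdsWithin_le_nhds)
  have heq : (fun u => slope T x u ^ 2) =ᶠ[𝓝[≠] x] fun u => 16 * slope s x u ^ 2 * (1 - T u) := by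
    filter_upwards [hrel.filter_mono nhdsWithin_le_nhds, self_mem_nhdsWithin] with u hu hux
    have hne : u - x ≠ 0 := sub_ne_zero.2 hux
    have hsx : s x = 1 / 2 := by linear_combination hσ / 2
    rw [slope_def_field, slope_def_field, hT2, hsx]
    field_simp
    linear_combination 4 * hu
  have := tendsto_nhds_unique (lim1.congr' heq) lim2
  simp [hd, h1'] at this

/-- The number `A` exists only pointwise in the hypothesis. Away from `s = 1/2` it is a rational
function of `s` and `T`, hence analytic, so the 2-jets of `s`, `T`, `y₀` can be written through
those of `A` and `Y` and `defect_quadratic` applies. -/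
lemma solvesAt_of_landen {e : Sing → ℂ} {s T y₀ Y : ℂ → ℂ} {x : ℂ} (he0 : e .zero = 0)
    (he1 : e .one = 0) (hs : RegularAt s y₀ x) (hT : RegularAt T Y x) (hx : 2 * s x - 1 ≠ 0)
    (h : ∀ᶠ u in 𝓝 x, ∃ A : ℂ, A ≠ 0 ∧ s u = (A + 1) ^ 2 / (4 * A) ∧ T u = 1 - A ^ 2 ∧
      y₀ u * (4 * A * (Y u - 1)) = -(Y u - 1 - A) ^ 2) (hsol : SolvesAt e s y₀ x) :
    SolvesAt (fun k => e (maninLabel k) / 4) T Y x := by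
  obtain ⟨hy0, hy1, hys⟩ := forall_ne_point_iff.1 hs.ne_point
  obtain ⟨hY0, hY1, hYT⟩ := forall_ne_point_iff.1 hT.ne_point
  have as := hs.analytic_left
  have aT := hT.analytic_left
  have aY := hT.analytic_right
  -- The analytic formula for `A`: the quotient of 2 - T = 1 + A² by 2(2s - 1) = (1 + A²) / A.
  set a : ℂ → ℂ := fun u => (2 - T u) / (2 * (2 * s u - 1)) with ha_def
  have haan : AnalyticAt ℂ a x := by
    apply AnalyticAt.div (by fun_prop) (by fun_prop)
    simpa using hx
  have hev : ∀ᶠ u in 𝓝 x, a u ≠ 0 ∧ s u = (a u + 1) ^ 2 / (4 * a u) ∧ T u = 1 - a u ^ 2 ∧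
      y₀ u = -(Y u - 1 - a u) ^ 2 / (4 * a u * (Y u - 1)) ∧ Y u - 1 ≠ 0 := by
    have c1 : ∀ᶠ u in 𝓝 x, 2 * s u - 1 ≠ 0 :=
      ContinuousAt.eventually_ne (by fun_prop (disch := exact as.continuousAt)) hx
    have c2 : ∀ᶠ u in 𝓝 x, Y u - 1 ≠ 0 := by
      filter_upwards [aY.continuousAt.eventually_ne hY1] with u hu using sub_ne_zero.2 hu
    filter_upwards [h, c1, c2] with u ⟨A, hA, h1, h2, h3⟩ hu hu2
    have haA : a u = A := by
      simp only [ha_def]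
      rw [div_eq_iff (mul_ne_zero two_ne_zero hu), h1, h2]
      field_simp
      ring
    rw [haA]
    exact ⟨hA, h1, h2, by rw [eq_div_iff (by simp [*]), h3], hu2⟩
  obtain ⟨ha0, hsx, hTx, hyx, hv0⟩ := hev.self_of_nhds
  have haev : ∀ᶠ u in 𝓝 x, a u ≠ 0 := hev.mono fun u hu => hu.1
  have ha' := haan.differentiableAt.hasDerivAt
  have ha2 := haan.deriv.differentiableAt.hasDerivAt
  have hY' := aY.differentiableAt.hasDerivAt
  have hY2 := aY.deriv.differentiableAt.hasDerivAt
  obtain ⟨s1, s2⟩ : deriv s x = (a x - 1) * (a x + 1) / (4 * a x ^ 2) * deriv a x ∧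
      deriv (deriv s) x = (a x - 1) * (a x + 1) / (4 * a x ^ 2) * deriv (deriv a) x +
        deriv a x ^ 2 / (2 * a x ^ 3) := by
    apply deriv_deriv_eq (f' := fun u => (a u - 1) * (a u + 1) / (4 * a u ^ 2) * deriv a u)
    · filter_upwards [hev.eventually_nhds, eventually_hasDerivAt haan] with u hu hau
      have hs : s =ᶠ[𝓝 u] fun u => (a u + 1) ^ 2 / (4 * a u) := hu.mono fun v hv => hv.2.1
      rw [hs.hasDerivAt_iff]
      have h0 := hu.self_of_nhds.1
      refine (((hau.add_const 1).pow 2).div (hau.const_mul 4) (by simp [h0])).congr_deriv ?_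
      simp only [Pi.pow_apply]
      field_simp
      ring
    · refine ((((ha'.sub_const 1).mul (ha'.add_const 1)).div ((ha'.pow 2).const_mul 4)
        (by simp [ha0])).mul ha2).congr_deriv ?_
      simp only [Pi.pow_apply, Pi.mul_apply, Pi.div_apply]
      field_simp
      ring
  obtain ⟨t1, t2⟩ : deriv T x = -2 * a x * deriv a x ∧
      deriv (deriv T) x = -2 * deriv a x ^ 2 - 2 * a x * deriv (deriv a) x := by
    apply deriv_deriv_eq (f' := fun u => -2 * a u * deriv a u)
    · filter_upwards [hev.eventually_nhds, eventually_hasDerivAt haan] with u hu hau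
      have hs : T =ᶠ[𝓝 u] fun u => 1 - a u ^ 2 := hu.mono fun v hv => hv.2.2.1
      rw [hs.hasDerivAt_iff]
      refine ((hau.pow 2).const_sub 1).congr_deriv ?_
      ring
    · refine ((ha'.const_mul (-2)).mul ha2).congr_deriv ?_
      ring
  obtain ⟨y1, y2⟩ : deriv y₀ x = -(deriv Y x / a x - (Y x - 1) * deriv a x / a x ^ 2
        + deriv a x / (Y x - 1) - a x * deriv Y x / (Y x - 1) ^ 2) / 4 ∧
      deriv (deriv y₀) x = -(deriv (deriv Y) x / a x - 2 * deriv Y x * deriv a x / a x ^ 2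
          - (Y x - 1) * deriv (deriv a) x / a x ^ 2 + 2 * (Y x - 1) * deriv a x ^ 2 / a x ^ 3
          + deriv (deriv a) x / (Y x - 1) - 2 * deriv a x * deriv Y x / (Y x - 1) ^ 2
          - a x * deriv (deriv Y) x / (Y x - 1) ^ 2
          + 2 * a x * deriv Y x ^ 2 / (Y x - 1) ^ 3) / 4 := by
    apply deriv_deriv_eq (f' := fun u => -(deriv Y u / a u - (Y u - 1) * deriv a u / a u ^ 2
        + deriv a u / (Y u - 1) - a u * deriv Y u / (Y u - 1) ^ 2) / 4)
    · filter_upwards [hev.eventually_nhds, eventually_hasDerivAt haan,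
        eventually_hasDerivAt aY] with u hu hau hYu
      have hs : y₀ =ᶠ[𝓝 u] fun u => -(Y u - 1 - a u) ^ 2 / (4 * a u * (Y u - 1)) :=
        hu.mono fun v hv => hv.2.2.2.1
      rw [hs.hasDerivAt_iff]
      have h0 := hu.self_of_nhds.1
      have h1 := hu.self_of_nhds.2.2.2.2
      refine (((((hYu.sub_const 1).sub hau).pow 2).neg).div
        ((hau.const_mul 4).mul (hYu.sub_const 1)) (by simp [h0, h1])).congr_deriv ?_
      simp only [Pi.pow_apply, Pi.mul_apply, Pi.neg_apply, Pi.sub_apply]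
      field_simp
      ring
    · refine (((((hY2.div ha' ha0).sub (((hY'.sub_const 1).mul ha2).div (ha'.pow 2)
        (by simp [ha0]))).add (ha2.div (hY'.sub_const 1) hv0)).sub ((ha'.mul hY2).div
        ((hY'.sub_const 1).pow 2) (by simp [hv0]))).neg.div_const 4).congr_deriv ?_
      simp only [Pi.pow_apply, Pi.mul_apply]
      field_simp
      ring
  rw [SolvesAt, s1, s2, y1, y2, hsx, hyx] at hsol
  have hfac : (a x - 1) * (a x + 1) ≠ 0 := by
    intro h0
    apply hT.left_ne_zero
    rw [hTx]
    linear_combination -h0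
  have ham := left_ne_zero_of_mul hfac
  have hap := right_ne_zero_of_mul hfac
  have ha1 : deriv a x ≠ 0 := by
    intro h0
    apply hT.deriv_ne
    rw [t1, h0, mul_zero]
  have hvm : Y x - 1 - a x ≠ 0 := by
    intro h0
    apply hy0
    rw [hyx, h0]
    simp
  have hvp : Y x - 1 + a x ≠ 0 := by
    intro h0
    apply hy1
    rw [hyx, div_eq_iff (by simp [ha0, hv0])]
    linear_combination (-(Y x - 1 + a x)) * h0
  have hva : Y x - 1 + a x ^ 2 ≠ 0 := by
    intro h0
    apply hYT
    rw [hTx]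
    linear_combination h0
  rw [defect_quadratic e he0 he1 ha0 ham hap ha1 hv0 (by simpa using hY0) hva hvm hvp] at hsol
  rw [SolvesAt, t1, t2, hTx]
  rw [sub_add_cancel] at hsol
  refine (mul_eq_zero.1 hsol).resolve_left (div_ne_zero ?_ ?_)
  · exact mul_ne_zero (mul_ne_zero (mul_ne_zero hvm hvp) ham) hap
  · simp [ha0, hv0]

/-! ### Fractional linear transformations of the sphere -/

/-- The fractional linear transformation with the given coefficients. -/
noncomputable def mobius (a b c d : ℂ) (h : a * d - b * c ≠ 0) :
    Matrix.GeneralLinearGroup (Fin 2) ℂ :=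
  Matrix.GeneralLinearGroup.mkOfDetNeZero !![a, b; c, d] (by simpa [Matrix.det_fin_two] using h)

section mobius

variable {a b c d : ℂ} (h : a * d - b * c ≠ 0)

@[simp] lemma mobius_zero_zero : mobius a b c d h 0 0 = a := rfl
@[simp] lemma mobius_zero_one : mobius a b c d h 0 1 = b := rfl
@[simp] lemma mobius_one_zero : mobius a b c d h 1 0 = c := rfl
@[simp] lemma mobius_one_one : mobius a b c d h 1 1 = d := rfl

lemma mobius_smul_coe_of_eq_zero {x : ℂ} (hx : c * x + d = 0) :
    mobius a b c d h • (x : OnePoint ℂ) = OnePoint.infty := by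
  rw [OnePoint.smul_some_eq_ite]
  exact if_pos hx

lemma mobius_smul_coe_of_ne_zero {x : ℂ} (hx : c * x + d ≠ 0) :
    mobius a b c d h • (x : OnePoint ℂ) = (((a * x + b) / (c * x + d) : ℂ) : OnePoint ℂ) := by
  rw [OnePoint.smul_some_eq_ite]
  exact if_neg hx

end mobius

lemma det_entries_ne_zero (g : Matrix.GeneralLinearGroup (Fin 2) ℂ) :
    g 0 0 * g 1 1 - g 0 1 * g 1 0 ≠ 0 := by
  have := g.det_ne_zero
  rwa [Matrix.det_fin_two] at this

/-- The action of `GL₂` on the sphere in homogeneous coordinates. -/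
lemma smul_ite_eq (g : Matrix.GeneralLinearGroup (Fin 2) ℂ) {u v : ℂ} (h : u ≠ 0 ∨ v ≠ 0) :
    g • (if v = 0 then OnePoint.infty else ((u / v : ℂ) : OnePoint ℂ)) =
      if g 1 0 * u + g 1 1 * v = 0 then OnePoint.infty
      else (((g 0 0 * u + g 0 1 * v) / (g 1 0 * u + g 1 1 * v) : ℂ) : OnePoint ℂ) := by
  by_cases hv : v = 0
  · have hu : u ≠ 0 := by simpa [hv] using h
    simp only [hv, if_true, OnePoint.smul_infty_eq_ite, mul_zero, add_zero, mul_eq_zero, hu,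
      or_false]
    split_ifs
    · rfl
    · rw [mul_div_mul_right _ _ hu]
  · simp only [hv, if_false, OnePoint.smul_some_eq_ite]
    have h1 : ∀ a b : ℂ, a * (u / v) + b = (a * u + b * v) / v := by
      intro a b
      field_simp
    rw [h1, h1]
    simp only [div_eq_zero_iff, hv, or_false]
    split_ifs
    · rfl
    · rw [div_div_div_cancel_right₀ hv]

/-- Three distinct points can be moved to `0`, `1`, `∞`. -/
lemma exists_smul_eq_zero_one_infty {x y z : OnePoint ℂ} (hxy : x ≠ y) (hxz : x ≠ z)
    (hyz : y ≠ z) : ∃ g : Matrix.GeneralLinearGroup (Fin 2) ℂ,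
      g • x = ((0 : ℂ) : OnePoint ℂ) ∧ g • y = ((1 : ℂ) : OnePoint ℂ) ∧ g • z = OnePoint.infty := by
  cases x with
  | infty =>
    cases y with
    | infty => exact absurd rfl hxy
    | coe y =>
      cases z with
      | infty => exact absurd rfl hxz
      | coe z =>
        have h : y - z ≠ 0 := by simpa [sub_eq_zero, OnePoint.coe_eq_coe] using hyz
        refine ⟨mobius 0 (y - z) 1 (-z) (by simpa [sub_eq_zero, eq_comm] using h),
          ?_, ?_, ?_⟩ <;>
          simp [OnePoint.smul_infty_eq_ite, OnePoint.smul_some_eq_ite, ← sub_eq_add_neg, h]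
  | coe x =>
    cases y with
    | infty =>
      cases z with
      | infty => exact absurd rfl hyz
      | coe z =>
        have h : x - z ≠ 0 := by simpa [sub_eq_zero, OnePoint.coe_eq_coe] using hxz
        refine ⟨mobius 1 (-x) 1 (-z) (by intro h'; apply h; linear_combination h'),
          ?_, ?_, ?_⟩ <;>
          simp [OnePoint.smul_infty_eq_ite, OnePoint.smul_some_eq_ite, ← sub_eq_add_neg, h]
    | coe y =>
      have h : y - x ≠ 0 := by simpa [sub_eq_zero, OnePoint.coe_eq_coe, eq_comm] using hxy
      cases z with
      | infty =>
        refine ⟨mobius 1 (-x) 0 (y - x) (by simpa using h), ?_, ?_, ?_⟩ <;>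
          simp [OnePoint.smul_infty_eq_ite, OnePoint.smul_some_eq_ite, ← sub_eq_add_neg, h]
      | coe z =>
        have h2 : x - z ≠ 0 := by simpa [sub_eq_zero, OnePoint.coe_eq_coe] using hxz
        have h3 : y - z ≠ 0 := by simpa [sub_eq_zero, OnePoint.coe_eq_coe] using hyz
        refine ⟨mobius (y - z) (-(y - z) * x) (y - x) (-(y - x) * z) ?_, ?_, ?_, ?_⟩
        · intro h'
          apply mul_ne_zero (mul_ne_zero h h2) h3
          linear_combination h'
        · rw [mobius_smul_coe_of_ne_zero]
          · congr 1
            rw [div_eq_zero_iff]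
            left
            ring
          · intro h'
            apply mul_ne_zero h h2
            linear_combination h'
        · have h4 : (y - x) * y + -(y - x) * z ≠ 0 := by
            intro h'
            apply mul_ne_zero h h3
            linear_combination h'
          rw [mobius_smul_coe_of_ne_zero _ h4]
          congr 1
          rw [div_eq_iff h4]
          ring
        · exact mobius_smul_coe_of_eq_zero _ (by ring)

lemma exists_smul_zero_infty_eq {x z : OnePoint ℂ} (hxz : x ≠ z) :
    ∃ g : Matrix.GeneralLinearGroup (Fin 2) ℂ,
      g • ((0 : ℂ) : OnePoint ℂ) = x ∧ g • (OnePoint.infty : OnePoint ℂ) = z := by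
  classical
  -- An arbitrary third point, only to make three-point transitivity applicable.
  obtain ⟨y, hy⟩ := Infinite.exists_notMem_finset ({x, z} : Finset (OnePoint ℂ))
  simp only [Finset.mem_insert, Finset.mem_singleton, not_or] at hy
  obtain ⟨g, h1, -, h2⟩ := exists_smul_eq_zero_one_infty (Ne.symm hy.1) hxz hy.2
  exact ⟨g⁻¹, by rw [← h1, inv_smul_smul], by rw [← h2, inv_smul_smul]⟩

/-- A fractional linear transformation is determined by the preimages of `0`, `1`, `∞`. -/
lemma smul_eq_self_of_fixed {g : Matrix.GeneralLinearGroup (Fin 2) ℂ}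
    (h0 : g • ((0 : ℂ) : OnePoint ℂ) = ((0 : ℂ) : OnePoint ℂ))
    (h1 : g • ((1 : ℂ) : OnePoint ℂ) = ((1 : ℂ) : OnePoint ℂ))
    (h2 : g • (OnePoint.infty : OnePoint ℂ) = OnePoint.infty) (x : OnePoint ℂ) : g • x = x := by
  rw [OnePoint.smul_infty_eq_self_iff] at h2
  have hdet := det_entries_ne_zero g
  rw [h2, mul_zero, sub_zero] at hdet
  have h11 := right_ne_zero_of_mul hdet
  simp only [OnePoint.smul_some_eq_ite, h2, zero_add, h11, if_false, mul_zero,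
    OnePoint.coe_eq_coe, div_eq_zero_iff, or_false] at h0
  simp only [OnePoint.smul_some_eq_ite, h2, zero_add, h11, if_false, mul_one, h0,
    add_zero, OnePoint.coe_eq_coe, div_eq_one_iff_eq h11] at h1
  cases x with
  | infty => rwa [OnePoint.smul_infty_eq_self_iff]
  | coe x => simp [OnePoint.smul_some_eq_ite, h2, h11, h0, h1]

lemma smul_eq_smul_of_eq {g k : Matrix.GeneralLinearGroup (Fin 2) ℂ} {x y z : OnePoint ℂ}
    (hx : g • x = ((0 : ℂ) : OnePoint ℂ)) (hx' : k • x = ((0 : ℂ) : OnePoint ℂ))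
    (hy : g • y = ((1 : ℂ) : OnePoint ℂ)) (hy' : k • y = ((1 : ℂ) : OnePoint ℂ))
    (hz : g • z = OnePoint.infty) (hz' : k • z = OnePoint.infty) (w : OnePoint ℂ) :
    g • w = k • w := by
  have := smul_eq_self_of_fixed (g := g * k⁻¹)
    (by rw [mul_smul, ← hx', inv_smul_smul, hx, hx'])
    (by rw [mul_smul, ← hy', inv_smul_smul, hy, hy'])
    (by rw [mul_smul, ← hz', inv_smul_smul, hz, hz']) (k • w)
  rwa [mul_smul, inv_smul_smul] at this

/-! ### Rational functions of degree two -/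

lemma max_natDegree_eq_two_iff {p q : ℂ[X]} :
    max p.natDegree q.natDegree = 2 ↔
      p.natDegree ≤ 2 ∧ q.natDegree ≤ 2 ∧ (p.coeff 2 ≠ 0 ∨ q.coeff 2 ≠ 0) := by
  constructor
  · intro h
    have hp : p.natDegree ≤ 2 := h ▸ le_max_left _ _
    have hq : q.natDegree ≤ 2 := h ▸ le_max_right _ _
    refine ⟨hp, hq, ?_⟩
    rcases max_choice p.natDegree q.natDegree with h' | h' <;> rw [h] at h'
    · left
      rw [h']
      exact Polynomial.leadingCoeff_ne_zero.2 (by rintro rfl; simp at h')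
    · right
      rw [h']
      exact Polynomial.leadingCoeff_ne_zero.2 (by rintro rfl; simp at h')
  · rintro ⟨hp, hq, h | h⟩
    · rw [le_antisymm hp (Polynomial.le_natDegree_of_ne_zero h), max_eq_left hq]
    · rw [le_antisymm hq (Polynomial.le_natDegree_of_ne_zero h), max_eq_right hp]

lemma eval_ne_zero_or_of_isCoprime {p q : ℂ[X]} (h : IsCoprime p q) (x : ℂ) :
    p.eval x ≠ 0 ∨ q.eval x ≠ 0 := by
  by_contra! h'
  obtain ⟨a, b, hab⟩ := h
  have := congrArg (Polynomial.eval x) hab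
  simp [h'.1, h'.2] at this

lemma smul_quadraticMap (g : Matrix.GeneralLinearGroup (Fin 2) ℂ) {p q : ℂ[X]}
    (hpq : IsCoprime p q) (hdeg : max p.natDegree q.natDegree = 2) (x : OnePoint ℂ) :
    g • quadraticMap p q x =
      quadraticMap (C (g 0 0) * p + C (g 0 1) * q) (C (g 1 0) * p + C (g 1 1) * q) x := by
  cases x with
  | infty =>
    have h := (max_natDegree_eq_two_iff.1 hdeg).2.2
    change g • (if q.coeff 2 = 0 then OnePoint.infty else
      ((p.coeff 2 / q.coeff 2 : ℂ) : OnePoint ℂ)) = if _ = 0 then _ else _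
    rw [smul_ite_eq g h]
    simp
  | coe x =>
    have h := eval_ne_zero_or_of_isCoprime hpq x
    change g • (if q.eval x = 0 then OnePoint.infty else
      ((p.eval x / q.eval x : ℂ) : OnePoint ℂ)) = if _ = 0 then _ else _
    rw [smul_ite_eq g h]
    simp

lemma IsQuadratic.smul {z : OnePoint ℂ → OnePoint ℂ} (hz : IsQuadratic z)
    (g : Matrix.GeneralLinearGroup (Fin 2) ℂ) : IsQuadratic fun x => g • z x := by
  obtain ⟨p, q, hpq, hdeg, rfl⟩ := hz
  have hdet := det_entries_ne_zero g
  refine ⟨C (g 0 0) * p + C (g 0 1) * q, C (g 1 0) * p + C (g 1 1) * q, ?_, ?_,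
    funext (smul_quadraticMap g hpq hdeg)⟩
  · obtain ⟨a, b, hab⟩ := hpq
    -- Bézout coefficients for the new pair are the old ones multiplied by the inverse matrix.
    set D := (g 0 0 * g 1 1 - g 0 1 * g 1 0)⁻¹ with hD
    refine ⟨C D * (a * C (g 1 1) - b * C (g 1 0)), C D * (b * C (g 0 0) - a * C (g 0 1)), ?_⟩
    have : C D * (C (g 0 0) * C (g 1 1) - C (g 0 1) * C (g 1 0)) = 1 := by
      rw [← C_mul, ← C_mul, ← C_sub, ← C_mul, hD, inv_mul_cancel₀ hdet, C_1]
    linear_combination hab + (a * p + b * q) * this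
  · obtain ⟨hp, hq, h⟩ := max_natDegree_eq_two_iff.1 hdeg
    refine max_natDegree_eq_two_iff.2 ⟨?_, ?_, ?_⟩
    · exact natDegree_add_le_of_degree_le ((natDegree_C_mul_le _ _).trans hp)
        ((natDegree_C_mul_le _ _).trans hq)
    · exact natDegree_add_le_of_degree_le ((natDegree_C_mul_le _ _).trans hp)
        ((natDegree_C_mul_le _ _).trans hq)
    · simp only [coeff_add, coeff_C_mul]
      by_contra! h'
      obtain ⟨h1, h2⟩ := h'
      have e1 : (g 0 0 * g 1 1 - g 0 1 * g 1 0) * p.coeff 2 = 0 := by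
        linear_combination g 1 1 * h1 - g 0 1 * h2
      have e2 : (g 0 0 * g 1 1 - g 0 1 * g 1 0) * q.coeff 2 = 0 := by
        linear_combination g 0 0 * h2 - g 1 0 * h1
      rcases h with h | h
      · exact h ((mul_eq_zero.1 e1).resolve_left hdet)
      · exact h ((mul_eq_zero.1 e2).resolve_left hdet)

/-- The squaring map of the Riemann sphere. -/
noncomputable def sphereSq : OnePoint ℂ → OnePoint ℂ := quadraticMap (X ^ 2) 1

@[simp] lemma sphereSq_infty : sphereSq OnePoint.infty = OnePoint.infty := by
  change (if _ = 0 then _ else _) = _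
  simp [coeff_one]

@[simp] lemma sphereSq_coe (x : ℂ) : sphereSq x = ((x ^ 2 : ℂ) : OnePoint ℂ) := by
  change (if _ = 0 then _ else _) = _
  simp

lemma isQuadratic_sphereSq : IsQuadratic sphereSq :=
  ⟨X ^ 2, 1, isCoprime_one_right, by simp, rfl⟩

lemma sphereSq_smul_infty (h : Matrix.GeneralLinearGroup (Fin 2) ℂ) :
    sphereSq (h • (OnePoint.infty : OnePoint ℂ)) = if h 1 0 ^ 2 = 0 then OnePoint.infty else
      ((h 0 0 ^ 2 / h 1 0 ^ 2 : ℂ) : OnePoint ℂ) := by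
  rw [OnePoint.smul_infty_eq_ite]
  split_ifs with h1 h2 h2 <;> simp_all [div_pow]

lemma sphereSq_smul_coe (h : Matrix.GeneralLinearGroup (Fin 2) ℂ) (x : ℂ) :
    sphereSq (h • (x : OnePoint ℂ)) = if (h 1 0 * x + h 1 1) ^ 2 = 0 then OnePoint.infty else
      (((h 0 0 * x + h 0 1) ^ 2 / (h 1 0 * x + h 1 1) ^ 2 : ℂ) : OnePoint ℂ) := by
  rw [OnePoint.smul_some_eq_ite]
  split_ifs with h1 h2 h2 <;> simp_all [div_pow]

/-- The zeros on the sphere of a polynomial, as a binary quadratic form. -/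
def formZeros (p : ℂ[X]) : Set (OnePoint ℂ)
  | OnePoint.infty => p.coeff 2 = 0
  | OnePoint.some x => p.eval x = 0

/-- A binary quadratic form over ℂ with one zero on the sphere has a double zero there. If the zero
is `∞`, the polynomial has no finite root and is constant; otherwise both finite roots coincide. -/
lemma eq_sq_of_formZeros_eq {p : ℂ[X]} (hp : p.natDegree ≤ 2) {a : OnePoint ℂ}
    (h : formZeros p = {a}) : ∃ u v : ℂ, p = (C u * X + C v) ^ 2 := by
  cases a with
  | infty =>
    have hroot : ∀ x : ℂ, p.eval x ≠ 0 := by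
      intro x hx
      have : (x : OnePoint ℂ) ∈ formZeros p := hx
      rw [h] at this
      exact OnePoint.coe_ne_infty x this
    have hdeg : p.degree = 0 := by
      by_contra hd
      obtain ⟨x, hx⟩ := IsAlgClosed.exists_root p hd
      exact hroot x hx
    rw [eq_C_of_degree_eq_zero hdeg]
    obtain ⟨v, hv⟩ := IsAlgClosed.exists_pow_nat_eq (p.coeff 0) two_pos
    refine ⟨0, v, ?_⟩
    simp [← hv]
  | coe a =>
    have h2 : p.coeff 2 ≠ 0 := by
      intro h2
      have : (OnePoint.infty : OnePoint ℂ) ∈ formZeros p := h2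
      rw [h] at this
      exact OnePoint.infty_ne_coe a this
    have hroot : ∀ x : ℂ, p.eval x = 0 → x = a := by
      intro x hx
      have : (x : OnePoint ℂ) ∈ formZeros p := hx
      rw [h] at this
      exact OnePoint.coe_eq_coe.1 this
    have ha : p.eval a = 0 := by
      have : (a : OnePoint ℂ) ∈ formZeros p := by rw [h]; rfl
      exact this
    have heval : ∀ x, p.eval x = p.coeff 2 * x ^ 2 + p.coeff 1 * x + p.coeff 0 := by
      intro x
      rw [eval_eq_sum_range' (Nat.lt_succ_of_le hp)]
      simp [Finset.sum_range_succ]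
      ring
    have ha' := ha
    rw [heval] at ha'
    -- The left side is the second root by Vieta, so it must equal the only root.
    have hb : -p.coeff 1 / p.coeff 2 - a = a := by
      apply hroot
      rw [heval]
      field_simp
      linear_combination p.coeff 2 * ha'
    have h1 : p.coeff 1 = -2 * a * p.coeff 2 := by
      field_simp at hb
      linear_combination -hb
    have h0 : p.coeff 0 = a ^ 2 * p.coeff 2 := by
      linear_combination ha' - a * h1
    obtain ⟨u, hu⟩ := IsAlgClosed.exists_pow_nat_eq (p.coeff 2) two_pos
    refine ⟨u, -u * a, ?_⟩
    apply Polynomial.funext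
    intro x
    rw [heval, h1, h0, ← hu]
    simp
    ring

/-- A quadratic rational function with single preimages of `A` and `B` is the squaring map up to
fractional linear transformations. -/
lemma IsQuadratic.exists_eq_smul_sphereSq {z : OnePoint ℂ → OnePoint ℂ} (hz : IsQuadratic z)
    {g : Matrix.GeneralLinearGroup (Fin 2) ℂ}
    (hA : (z ⁻¹' {g • ((0 : ℂ) : OnePoint ℂ)}).ncard = 1)
    (hB : (z ⁻¹' {g • (OnePoint.infty : OnePoint ℂ)}).ncard = 1) :
    ∃ h : Matrix.GeneralLinearGroup (Fin 2) ℂ, z = fun x => g • sphereSq (h • x) := by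
  obtain ⟨p, q, hpq, hdeg, hz'⟩ := hz.smul g⁻¹
  have hz1 : ∀ x, z x = g • quadraticMap p q x := by
    intro x
    rw [← hz', smul_inv_smul]
  obtain ⟨hp, hq, hc⟩ := max_natDegree_eq_two_iff.1 hdeg
  have hP : z ⁻¹' {g • ((0 : ℂ) : OnePoint ℂ)} = formZeros p := by
    ext x
    rw [Set.mem_preimage, Set.mem_singleton_iff, hz1, smul_left_cancel_iff]
    cases x with
    | infty =>
      change (if q.coeff 2 = 0 then OnePoint.infty else _) = _ ↔ p.coeff 2 = 0
      split_ifs with h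
      · simp [h] at hc
        simp [hc]
      · simp [h]
    | coe x =>
      have := eval_ne_zero_or_of_isCoprime hpq x
      change (if q.eval x = 0 then OnePoint.infty else _) = _ ↔ p.eval x = 0
      split_ifs with h
      · simp [h] at this
        simp [this]
      · simp [h]
  have hQ : z ⁻¹' {g • (OnePoint.infty : OnePoint ℂ)} = formZeros q := by
    ext x
    rw [Set.mem_preimage, Set.mem_singleton_iff, hz1, smul_left_cancel_iff]
    cases x with
    | infty =>
      change (if q.coeff 2 = 0 then OnePoint.infty else _) = _ ↔ q.coeff 2 = 0
      split_ifs with h <;> simp [h]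
    | coe x =>
      change (if q.eval x = 0 then OnePoint.infty else _) = _ ↔ q.eval x = 0
      split_ifs with h <;> simp [h]
  rw [hP, Set.ncard_eq_one] at hA
  rw [hQ, Set.ncard_eq_one] at hB
  obtain ⟨a, ha⟩ := hA
  obtain ⟨b, hb⟩ := hB
  obtain ⟨u, v, huv⟩ := eq_sq_of_formZeros_eq hp ha
  obtain ⟨u', v', huv'⟩ := eq_sq_of_formZeros_eq hq hb
  have hc2 : ∀ u v : ℂ, ((C u * X + C v) ^ 2 : ℂ[X]).coeff 2 = u ^ 2 := by
    intro u v
    have : ((C u * X + C v) ^ 2 : ℂ[X]) = C (u ^ 2) * X ^ 2 + C (2 * u * v) * X ^ 1 + C (v ^ 2) := by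
      simp only [C_pow, C_mul, C_ofNat]
      ring
    rw [this]
    simp only [coeff_add, coeff_C_mul, coeff_X_pow, coeff_C]
    simp
  -- Proportional linear forms would have a common zero: a finite one contradicts coprimality, and
  -- one at `∞` contradicts degree two.
  have hdet : u * v' - v * u' ≠ 0 := by
    intro h0
    by_cases hu' : u' = 0
    · have hu : u ≠ 0 := by
        rintro rfl
        rw [huv, huv', hc2, hc2] at hc
        simp [hu'] at hc
      have hv' : v' = 0 := by simpa [hu', hu] using h0
      have := eval_ne_zero_or_of_isCoprime hpq (-v / u)
      rw [huv, huv'] at this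
      simp [hu', hv', mul_div_cancel₀ _ hu] at this
    · have := eval_ne_zero_or_of_isCoprime hpq (-v' / u')
      rw [huv, huv'] at this
      simp only [eval_pow, eval_add, eval_mul, eval_C, eval_X, ne_eq, OfNat.ofNat_ne_zero,
        not_false_eq_true, pow_eq_zero_iff, mul_div_cancel₀ _ hu', neg_add_cancel,
        not_true_eq_false, or_false] at this
      apply this
      field_simp
      linear_combination -h0
  refine ⟨mobius u v u' v' hdet, funext fun x => ?_⟩
  rw [hz1]
  congr 1
  cases x with
  | infty =>
    rw [sphereSq_smul_infty]
    change (if q.coeff 2 = 0 then OnePoint.infty else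
      ((p.coeff 2 / q.coeff 2 : ℂ) : OnePoint ℂ)) = _
    rw [huv, huv', hc2, hc2]
    simp
  | coe x =>
    rw [sphereSq_smul_coe]
    change (if q.eval x = 0 then OnePoint.infty else
      ((p.eval x / q.eval x : ℂ) : OnePoint ℂ)) = _
    rw [huv, huv']
    simp

/-! ### Reduction to the normal form -/

/-- The quadratic map `x ↦ g • (h • x)²` has critical values labelled `p₁`, `p₂`, and takes the
points `0, 1, T, ∞` to the points labelled by `i` among `0, 1, s, ∞`. -/
structure IsLabelled (p₁ p₂ : Sing) (i : Sing → Sing) (s T : ℂ)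
    (g h : Matrix.GeneralLinearGroup (Fin 2) ℂ) : Prop where
  zero : g • ((0 : ℂ) : OnePoint ℂ) = p₁.point s
  infty : g • (OnePoint.infty : OnePoint ℂ) = p₂.point s
  label : ∀ k : Sing, g • sphereSq (h • k.point T) = (i k).point s

lemma IsLabelled.transport {p₁ p₂ : Sing} {i j : Sing → Sing} {s T : ℂ}
    {g h : Matrix.GeneralLinearGroup (Fin 2) ℂ} (hl : IsLabelled p₁ p₂ i s T g h)
    {ρ σ : Equiv.Perm Sing} {μ μ' : ℂ → ℂ} {ν ν' : ℂ → ℂ → ℂ}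
    {M M' : ℂ → Matrix.GeneralLinearGroup (Fin 2) ℂ} (hρ : IsSymmetry ρ μ ν M)
    (hσ : IsSymmetry σ μ' ν' M') (hs0 : s ≠ 0) (hs1 : s ≠ 1) (hT0 : T ≠ 0) (hT1 : T ≠ 1)
    (hij : ∀ k, ρ (i k) = j (σ k)) :
    IsLabelled (ρ p₁) (ρ p₂) j (μ s) (μ' T) (M s * g) (h * (M' T)⁻¹) where
  zero := by rw [mul_smul, hl.zero, hρ.smul_point s hs0 hs1]
  infty := by rw [mul_smul, hl.infty, hρ.smul_point s hs0 hs1]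
  label k := by
    obtain ⟨k, rfl⟩ := σ.surjective k
    rw [← hσ.smul_point T hT0 hT1, mul_smul, mul_smul, inv_smul_smul, hl.label,
      hρ.smul_point s hs0 hs1, hij]

lemma smul_sphereSq_ite (g : Matrix.GeneralLinearGroup (Fin 2) ℂ) {u v : ℂ}
    (h : u ≠ 0 ∨ v ≠ 0) :
    g • (if v ^ 2 = 0 then OnePoint.infty else ((u ^ 2 / v ^ 2 : ℂ) : OnePoint ℂ)) =
      if g 1 0 * u ^ 2 + g 1 1 * v ^ 2 = 0 then OnePoint.infty
      else (((g 0 0 * u ^ 2 + g 0 1 * v ^ 2) / (g 1 0 * u ^ 2 + g 1 1 * v ^ 2) : ℂ) :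
        OnePoint ℂ) :=
  smul_ite_eq g (by simpa using h)

lemma linear_ne_zero (h : Matrix.GeneralLinearGroup (Fin 2) ℂ) (x : ℂ) :
    h 0 0 * x + h 0 1 ≠ 0 ∨ h 1 0 * x + h 1 1 ≠ 0 := by
  by_contra! h'
  apply det_entries_ne_zero h
  by_cases h0 : h 1 0 = 0
  · have : h 1 1 = 0 := by simpa [h0] using h'.2
    rw [h0, this]
    ring
  · refine (mul_eq_zero.1 ?_).resolve_left h0
    linear_combination h 0 0 * h 1 0 * h'.2 - h 1 0 ^ 2 * h'.1

lemma smul_sphereSq_eq_coe {g h : Matrix.GeneralLinearGroup (Fin 2) ℂ} {x y : ℂ}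
    (hy : g • sphereSq (h • (x : OnePoint ℂ)) = (y : OnePoint ℂ)) :
    g 0 0 * (h 0 0 * x + h 0 1) ^ 2 + g 0 1 * (h 1 0 * x + h 1 1) ^ 2 =
      y * (g 1 0 * (h 0 0 * x + h 0 1) ^ 2 + g 1 1 * (h 1 0 * x + h 1 1) ^ 2) := by
  rw [sphereSq_smul_coe, smul_sphereSq_ite g (linear_ne_zero h x)] at hy
  split_ifs at hy with h0
  · exact absurd hy (OnePoint.infty_ne_coe _)
  rwa [OnePoint.coe_eq_coe, div_eq_iff h0] at hy

lemma smul_sphereSq_eq_infty {g h : Matrix.GeneralLinearGroup (Fin 2) ℂ} {x : ℂ}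
    (hy : g • sphereSq (h • (x : OnePoint ℂ)) = OnePoint.infty) :
    g 1 0 * (h 0 0 * x + h 0 1) ^ 2 + g 1 1 * (h 1 0 * x + h 1 1) ^ 2 = 0 := by
  rw [sphereSq_smul_coe, smul_sphereSq_ite g (linear_ne_zero h x)] at hy
  by_contra h0
  rw [if_neg h0] at hy
  exact OnePoint.coe_ne_infty _ hy

/-- Since `g` sends `0, ∞` to `0, 1`, it is x ↦ αx / (αx + δ). The points `1` and `∞` are the two
poles of the quadratic map, so `h` takes opposite values at them. This places the critical points,
the zero and the pole of `h`, symmetrically at `1 + A` and `1 - A`, and determines the map up to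
`A`. Evaluation at `0` gives `s`, and `T` is the other point of the same fibre. -/
lemma IsLabelled.exists_landen {s T : ℂ} {g h : Matrix.GeneralLinearGroup (Fin 2) ℂ}
    (hl : IsLabelled .zero .one maninLabel s T g h) (hT0 : T ≠ 0) :
    ∃ A : ℂ, A ≠ 0 ∧ s = (A + 1) ^ 2 / (4 * A) ∧ T = 1 - A ^ 2 ∧
      ∀ Y y₀ : ℂ, g • sphereSq (h • (Y : OnePoint ℂ)) = (y₀ : OnePoint ℂ) →
        y₀ * (4 * A * (Y - 1)) = -(Y - 1 - A) ^ 2 := by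
  obtain ⟨hz, hi, hk⟩ := hl
  have hdet := det_entries_ne_zero g
  have hdet' := det_entries_ne_zero h
  have g01 : g 0 1 = 0 := by
    simp only [Sing.point, OnePoint.smul_some_eq_ite, mul_zero, zero_add] at hz
    split_ifs at hz with h0
    · exact absurd hz (OnePoint.infty_ne_coe _)
    rw [OnePoint.coe_eq_coe, div_eq_zero_iff] at hz
    exact hz.resolve_right h0
  have g10 : g 1 0 = g 0 0 := by
    simp only [Sing.point, OnePoint.smul_infty_eq_ite] at hi
    split_ifs at hi with h0
    · exact absurd hi (OnePoint.infty_ne_coe _)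
    rw [OnePoint.coe_eq_coe, div_eq_one_iff_eq h0] at hi
    exact hi.symm
  have k0 := smul_sphereSq_eq_coe (hk .zero)
  have k1 := smul_sphereSq_eq_infty (hk .one)
  have kT := smul_sphereSq_eq_coe (hk .t)
  have ki : g 1 0 * h 0 0 ^ 2 + g 1 1 * h 1 0 ^ 2 = 0 := by
    have := hk .infty
    have hne : h 0 0 ≠ 0 ∨ h 1 0 ≠ 0 := by
      by_contra! h'
      apply hdet'
      rw [h'.1, h'.2]
      ring
    simp only [Sing.point, maninLabel, sphereSq_smul_infty, smul_sphereSq_ite g hne] at this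
    by_contra h0
    rw [if_neg h0] at this
    exact OnePoint.coe_ne_infty _ this
  have hY := fun Y y₀ : ℂ => smul_sphereSq_eq_coe (g := g) (h := h) (x := Y) (y := y₀)
  rw [g01, zero_mul, sub_zero] at hdet
  rw [g10] at ki k0 k1 kT
  rw [g01] at k0 kT
  simp only [g10, g01] at hY
  generalize g 0 0 = α at *
  generalize g 1 1 = δ at *
  generalize h 0 0 = a at *
  generalize h 0 1 = b at *
  generalize h 1 0 = c at *
  generalize h 1 1 = d at *
  have hα := left_ne_zero_of_mul hdet
  have hδ := right_ne_zero_of_mul hdet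
  have hc : c ≠ 0 := by
    rintro rfl
    have : a = 0 := by simpa [hα] using ki
    exact hdet' (by rw [this]; ring)
  have ha : a ≠ 0 := by
    rintro rfl
    have : c = 0 := by simpa [hδ] using ki
    exact hc this
  have hδ' : δ = -α * a ^ 2 / c ^ 2 := by
    rw [eq_div_iff (pow_ne_zero 2 hc)]
    linear_combination ki
  -- Equality of the squares of `h` at `1` and `∞`, factored: the first factor would mean equal
  -- values, the second means opposite ones.
  have hprod : (a * d - b * c) * (2 * a * c + b * c + a * d) = 0 := by
    have : α * ((a * d - b * c) * (2 * a * c + b * c + a * d)) = 0 := by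
      linear_combination (-c ^ 2) * k1 + (c + d) ^ 2 * ki
    exact (mul_eq_zero.1 this).resolve_left hα
  have hlin := (mul_eq_zero.1 hprod).resolve_left hdet'
  -- Chosen so that the zero `-b / a` of `h` is `1 + A`.
  obtain ⟨A, hA⟩ : ∃ A, A = -1 - b / a := ⟨_, rfl⟩
  have hb : b = -(1 + A) * a := by
    rw [hA]
    field_simp
    ring
  have hd : d = -c * (1 - A) := by
    apply mul_left_cancel₀ ha
    rw [hb] at hlin
    linear_combination hlin
  have hA0 : A ≠ 0 := by
    intro h0
    apply hdet'
    rw [hb, hd, h0]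
    ring
  have hgen : ∀ Y y₀ : ℂ, α * (a * Y + b) ^ 2 + 0 * (c * Y + d) ^ 2 =
      y₀ * (α * (a * Y + b) ^ 2 + δ * (c * Y + d) ^ 2) →
      y₀ * (4 * A * (Y - 1)) = -(Y - 1 - A) ^ 2 := by
    intro Y y₀ h
    rw [hb, hd, hδ'] at h
    apply mul_left_cancel₀ (mul_ne_zero hα (pow_ne_zero 2 ha))
    field_simp at h
    linear_combination h
  have r0 := hgen _ _ k0
  have rT := hgen _ _ kT
  refine ⟨A, hA0, ?_, ?_, fun Y y₀ h => hgen Y y₀ (hY Y y₀ h)⟩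
  · rw [eq_div_iff (by simp [hA0])]
    linear_combination -r0
  -- The fibre over `s` contains `0` as well as `T`, so the factor `T` of the resulting quadratic
  -- equation is cancelled.
  · apply mul_left_cancel₀ hT0
    linear_combination (T - 1) * r0 + rT

lemma exists_perm_eq {p₁ p₂ : Sing} (h : p₁ ≠ p₂) :
    ∃ ρ : Equiv.Perm Sing, ρ p₁ = .zero ∧ ρ p₂ = .one := by
  revert p₁ p₂
  decide

/-- Four labels taking only the values `t` and `∞`, each at most twice, take each exactly twice, as
`maninLabel` does. -/
lemma exists_perm_maninLabel {j : Sing → Sing} (h0 : ∀ k, j k ≠ .zero) (h1 : ∀ k, j k ≠ .one)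
    (hcard : ∀ l, {k | j k = l}.ncard ≤ 2) :
    ∃ σ : Equiv.Perm Sing, ∀ k, j k = maninLabel (σ k) := by
  have hcard' : ∀ l, (Finset.univ.filter fun k => j k = l).card ≤ 2 := by
    intro l
    rw [← Set.ncard_coe_finset]
    simpa using hcard l
  have key : ∀ a b c d : Sing, a ≠ .zero → b ≠ .zero → c ≠ .zero → d ≠ .zero →
      a ≠ .one → b ≠ .one → c ≠ .one → d ≠ .one →
      (∀ l, ((if a = l then 1 else 0) + (if b = l then 1 else 0) + (if c = l then 1 else 0) +
        (if d = l then 1 else 0)) ≤ 2) →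
      ∃ σ : Equiv.Perm Sing, a = maninLabel (σ .zero) ∧ b = maninLabel (σ .one) ∧
        c = maninLabel (σ .t) ∧ d = maninLabel (σ .infty) := by
    intro a b c d
    cases a <;> cases b <;> cases c <;> cases d <;> decide
  obtain ⟨σ, e0, e1, e2, e3⟩ := key (j .zero) (j .one) (j .t) (j .infty) (h0 _) (h0 _) (h0 _)
    (h0 _) (h1 _) (h1 _) (h1 _) (h1 _) (by
      intro l
      have := hcard' l
      rw [Finset.card_filter] at this
      -- The sum over `Sing` unfolds along the explicit list in its `Fintype` instance.
      change _ + (_ + (_ + (_ + 0))) ≤ 2 at this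
      beta_reduce at this
      omega)
  refine ⟨σ, fun k => ?_⟩
  cases k <;> assumption

/-! ### General transformations through the normal form -/

namespace IsTransformation

variable {U : Set ℂ} {P : Finset Sing} {z : ℂ → OnePoint ℂ → OnePoint ℂ}
  {m : ℂ → Matrix.GeneralLinearGroup (Fin 2) ℂ} {τ : ℂ → OnePoint ℂ} {T : ℂ → ℂ} {i : Sing → Sing}

lemma ne_zero (hT : IsTransformation U P z m τ T i) {u : ℂ} (hu : u ∈ U) : u ≠ 0 :=
  fun h => hT.zero_notMem (h ▸ hu)

lemma ne_one (hT : IsTransformation U P z m τ T i) {u : ℂ} (hu : u ∈ U) : u ≠ 1 :=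
  fun h => hT.one_notMem (h ▸ hu)

/-- The parameter `t` in the normalisation must be `T u`, because `T u` is the image of a
non-apparent point and differs from `0`, `1`, `∞`. -/
lemma image_nonApparent (hT : IsTransformation U P z m τ T i) {u : ℂ} (hu : u ∈ U) :
    (fun x => m u • x) '' nonApparent u P (z u) = Set.range (Sing.point (T u)) := by
  obtain ⟨-, t, -, -, ht⟩ := hT.normalizing u hu
  obtain ⟨h, h0, h1⟩ := hT.smul_tau u hu
  have hmem : (T u : OnePoint ℂ) ∈ Set.range (Sing.point t) := by
    rw [← ht, ← h]
    exact ⟨τ u, hT.mem_nonApparent u hu, rfl⟩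
  obtain ⟨k, hk⟩ := hmem
  have : t = T u := by
    cases k
    · exact absurd (OnePoint.coe_eq_coe.1 hk).symm h0
    · exact absurd (OnePoint.coe_eq_coe.1 hk).symm h1
    · exact OnePoint.coe_eq_coe.1 hk
    · exact absurd hk (OnePoint.infty_ne_coe _)
  rw [ht, this]

lemma label_notMem (hT : IsTransformation U P z m τ T i) {u : ℂ} (hu : u ∈ U) (k : Sing) :
    i k ∉ P := by
  have : k.point (T u) ∈ (fun x => m u • x) '' nonApparent u P (z u) := by
    rw [hT.image_nonApparent hu]
    exact ⟨k, rfl⟩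
  obtain ⟨x, ⟨j, hj, hx⟩, hxk⟩ := this
  have hl := hT.label u hu k
  rw [← hxk, inv_smul_smul, hx] at hl
  rwa [← point_injective (hT.ne_zero hu) (hT.ne_one hu) hl]

/-- The points `z̃⁻¹(k)` are distinct, and those with the same label lie in one fibre of `z`, which
has at most two points. -/
lemma ncard_label_le (hT : IsTransformation U P z m τ T i) {u : ℂ} (hu : u ∈ U) (j : Sing) :
    {k | i k = j}.ncard ≤ 2 := by
  obtain ⟨-, -, h1, h2⟩ := hT.belyi u hu
  have hle : (z u ⁻¹' {j.point u}).ncard ≤ 2 ∧ (z u ⁻¹' {j.point u}).ncard ≠ 0 := by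
    by_cases hj : j ∈ P
    · rw [h1 j hj]
      simp
    · rw [h2 j hj]
      simp
  refine le_trans (Set.ncard_le_ncard_of_injOn (fun k => (m u)⁻¹ • k.point (T u)) ?_ ?_
    (Set.finite_of_ncard_ne_zero hle.2)) hle.1
  · intro k hk
    simp only [Set.mem_ofPred_eq] at hk
    simp [hT.label u hu, hk]
  · intro k _ k' _ h
    obtain ⟨-, h0, h1⟩ := hT.smul_tau u hu
    exact point_injective h0 h1 (MulAction.injective _ h)

lemma exists_isLabelled (hT : IsTransformation U P z m τ T i) {p₁ p₂ : Sing} (hp : p₁ ≠ p₂)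
    (hP : P = {p₁, p₂}) {u : ℂ} (hu : u ∈ U) :
    ∃ g h, IsLabelled p₁ p₂ i u (T u) g h ∧
      ∀ w, z u w = g • sphereSq (h • m u • w) := by
  obtain ⟨hq, -, h1, -⟩ := hT.belyi u hu
  have hne : p₁.point u ≠ p₂.point u :=
    fun h => hp (point_injective (hT.ne_zero hu) (hT.ne_one hu) h)
  obtain ⟨g, hg0, hg1⟩ := exists_smul_zero_infty_eq hne
  obtain ⟨h, hh⟩ := hq.exists_eq_smul_sphereSq (g := g)
    (by rw [hg0]; exact h1 p₁ (by simp [hP])) (by rw [hg1]; exact h1 p₂ (by simp [hP]))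
  refine ⟨g, h * (m u)⁻¹, ⟨hg0, hg1, fun k => ?_⟩, fun w => ?_⟩
  · rw [← hT.label u hu k, hh, mul_smul]
  · rw [hh, mul_smul, inv_smul_smul]

/-- After symmetries of source and target, the transformation is given by explicit formulas. -/
lemma exists_landen (hT : IsTransformation U P z m τ T i) {u₀ : ℂ} (hu₀ : u₀ ∈ U) :
    ∃ (ρ σ : Equiv.Perm Sing) (μ μ' : ℂ → ℂ) (ν ν' : ℂ → ℂ → ℂ)
      (M M' : ℂ → Matrix.GeneralLinearGroup (Fin 2) ℂ),
      IsSymmetry ρ μ ν M ∧ IsSymmetry σ μ' ν' M' ∧ (∀ k, ρ (i k) = maninLabel (σ k)) ∧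
      ρ.symm .zero ∈ P ∧ ρ.symm .one ∈ P ∧
      ∀ u ∈ U, ∃ A : ℂ, A ≠ 0 ∧ μ u = (A + 1) ^ 2 / (4 * A) ∧ μ' (T u) = 1 - A ^ 2 ∧
        ∀ Y y₀ : ℂ, (∀ k : Sing, (Y : OnePoint ℂ) ≠ k.point (T u)) →
          (∀ k : Sing, (y₀ : OnePoint ℂ) ≠ k.point u) →
          (∃ w, z u w = (y₀ : OnePoint ℂ) ∧ m u • w = (Y : OnePoint ℂ)) →
          ν u y₀ * (4 * A * (ν' (T u) Y - 1)) = -(ν' (T u) Y - 1 - A) ^ 2 := by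
  obtain ⟨p₁, p₂, hp, hP⟩ := Finset.card_eq_two.1 (hT.belyi u₀ hu₀).2.1
  -- The source symmetry `ρ` moves the critical labels to `0, 1`; the target symmetry `σ` then
  -- arranges the remaining labels as in `maninLabel`. Both depend only on labels, hence serve all
  -- of `U` at once.
  obtain ⟨ρ, hρ1, hρ2⟩ := exists_perm_eq hp
  have hnot : ∀ k, i k ≠ p₁ ∧ i k ≠ p₂ := by
    intro k
    have := hT.label_notMem hu₀ k
    rw [hP] at this
    simpa using this
  obtain ⟨σ, hσ⟩ := exists_perm_maninLabel (j := fun k => ρ (i k))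
    (fun k h => (hnot k).1 (ρ.injective (h.trans hρ1.symm)))
    (fun k h => (hnot k).2 (ρ.injective (h.trans hρ2.symm))) (by
      intro l
      have := hT.ncard_label_le hu₀ (ρ.symm l)
      simpa only [Equiv.eq_symm_apply] using this)
  obtain ⟨μ, ν, M, hμ⟩ := exists_isSymmetry ρ
  obtain ⟨μ', ν', M', hμ'⟩ := exists_isSymmetry σ
  refine ⟨ρ, σ, μ, μ', ν, ν', M, M', hμ, hμ', hσ, ?_, ?_, ?_⟩
  · rw [← hρ1, Equiv.symm_apply_apply, hP]
    simp
  · rw [← hρ2, Equiv.symm_apply_apply, hP]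
    simp
  · intro u hu
    obtain ⟨g, h, hl, hz⟩ := hT.exists_isLabelled hp hP hu
    obtain ⟨-, hT0, hT1⟩ := hT.smul_tau u hu
    have hu0 := hT.ne_zero hu
    have hu1 := hT.ne_one hu
    have hl' := hl.transport hμ hμ' hu0 hu1 hT0 hT1 hσ
    rw [hρ1, hρ2] at hl'
    obtain ⟨A, hA, h1, h2, h3⟩ := hl'.exists_landen (hμ'.ne_zero _ hT0 hT1)
    refine ⟨A, hA, h1, h2, fun Y y₀ hY hy ⟨w, hw1, hw2⟩ => h3 _ _ ?_⟩
    rw [← hμ'.smul_coe _ hT0 hT1 Y hY, mul_smul, mul_smul, inv_smul_smul, ← hw2, ← hz, hw1,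
      hμ.smul_coe _ hu0 hu1 y₀ hy]

lemma analyticAt (hT : IsTransformation U P z m τ T i) {u : ℂ} (hu : u ∈ U) :
    AnalyticAt ℂ T u :=
  hT.holomorphic.analyticAt (hT.isOpen.mem_nhds hu)

lemma deriv_ne_zero (hT : IsTransformation U P z m τ T i) {u : ℂ} (hu : u ∈ U) :
    deriv T u ≠ 0 := by
  obtain ⟨ρ, σ, μ, μ', ν, ν', M, M', hμ, hμ', -, -, -, h⟩ := hT.exists_landen hu
  obtain ⟨-, hT0, hT1⟩ := hT.smul_tau u hu
  have hu0 := hT.ne_zero hu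
  have hu1 := hT.ne_one hu
  have hμT := hμ'.analyticAt _ hT0 hT1
  have key : deriv (μ' ∘ T) u ≠ 0 := by
    refine deriv_ne_zero_of_landen (s := μ) (hμ.analyticAt u hu0 hu1) (hμT.comp (hT.analyticAt hu))
      (hμ.deriv_ne u hu0 hu1) (hμ'.ne_one _ hT0 hT1) ?_
    filter_upwards [hT.isOpen.mem_nhds hu] with v hv
    obtain ⟨A, hA, h1, h2, -⟩ := h v hv
    exact ⟨A, hA, h1, h2⟩
  rw [(hμT.differentiableAt.hasDerivAt.comp u
    (hT.analyticAt hu).differentiableAt.hasDerivAt).deriv] at key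
  exact right_ne_zero_of_mul key

/-- Singular points of the new equation lie over singular points of the old one, so a branch over a
regular value is regular. -/
lemma ne_point_of_isBranch (hT : IsTransformation U P z m τ T i) {u : ℂ} (hu : u ∈ U) {y₀ Y : ℂ}
    (hy : ∀ k : Sing, (y₀ : OnePoint ℂ) ≠ k.point u)
    (h : ∃ w, z u w = (y₀ : OnePoint ℂ) ∧ m u • w = (Y : OnePoint ℂ)) (k : Sing) :
    (Y : OnePoint ℂ) ≠ k.point (T u) := by
  rintro hk
  obtain ⟨w, h1, h2⟩ := h
  apply hy (i k)
  rw [← h1, ← hT.label u hu, ← hk, ← h2, inv_smul_smul]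

/-- The equation is carried to the normal form by the source symmetry, across the quadratic
substitution by `solvesAt_of_landen`, and back by the target symmetry. The label identity `hσ` makes
the permuted parameters agree. -/
lemma solvesAt (hT : IsTransformation U P z m τ T i) {e : Sing → ℂ} (he : ∀ k ∈ P, e k = 0)
    {y₀ Y : ℂ → ℂ} {ρ σ : Equiv.Perm Sing} {μ μ' : ℂ → ℂ} {ν ν' : ℂ → ℂ → ℂ}
    {M M' : ℂ → Matrix.GeneralLinearGroup (Fin 2) ℂ}
    (hμ : IsSymmetry ρ μ ν M) (hμ' : IsSymmetry σ μ' ν' M')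
    (hσ : ∀ k, ρ (i k) = maninLabel (σ k)) (h0 : ρ.symm .zero ∈ P) (h1 : ρ.symm .one ∈ P)
    (hL : ∀ u ∈ U, ∃ A : ℂ, A ≠ 0 ∧ μ u = (A + 1) ^ 2 / (4 * A) ∧ μ' (T u) = 1 - A ^ 2 ∧
        ∀ Y y₀ : ℂ, (∀ k : Sing, (Y : OnePoint ℂ) ≠ k.point (T u)) →
          (∀ k : Sing, (y₀ : OnePoint ℂ) ≠ k.point u) →
          (∃ w, z u w = (y₀ : OnePoint ℂ) ∧ m u • w = (Y : OnePoint ℂ)) →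
          ν u y₀ * (4 * A * (ν' (T u) Y - 1)) = -(ν' (T u) Y - 1 - A) ^ 2)
    {u : ℂ} (hu : u ∈ U) (hy : AnalyticAt ℂ y₀ u) (hY : AnalyticAt ℂ Y u)
    (hyp : ∀ᶠ v in 𝓝 u, ∀ k : Sing, (y₀ v : OnePoint ℂ) ≠ k.point v)
    (hb : ∀ᶠ v in 𝓝 u, ∃ w, z v w = (y₀ v : OnePoint ℂ) ∧ m v • w = (Y v : OnePoint ℂ))
    (hgen : 2 * μ u - 1 ≠ 0) (hsol : SolvesAt e id y₀ u) :
    SolvesAt (fun k => e (i k) / 4) T Y u := by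
  obtain ⟨-, hT0, hT1⟩ := hT.smul_tau u hu
  have hr : RegularAt id y₀ u := ⟨analyticAt_id, hy, by simp, hT.ne_zero hu, hT.ne_one hu,
    hyp.self_of_nhds⟩
  have hr' : RegularAt T Y u := ⟨hT.analyticAt hu, hY, hT.deriv_ne_zero hu, hT0, hT1,
    hT.ne_point_of_isBranch hu hyp.self_of_nhds hb.self_of_nhds⟩
  have key := solvesAt_of_landen (e := e ∘ ρ.symm) (s := fun v => μ (id v))
    (T := fun v => μ' (T v)) (y₀ := fun v => ν (id v) (y₀ v)) (Y := fun v => ν' (T v) (Y v))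
    (x := u) (he _ h0) (he _ h1) (hμ.regularAt hr) (hμ'.regularAt hr') hgen ?_
    ((hμ.solvesAt_iff e id y₀ u hr).2 hsol)
  · rw [← hμ'.solvesAt_iff _ T Y u hr']
    convert key using 1
    funext k
    have : i (σ.symm k) = ρ.symm (maninLabel k) := by
      rw [Equiv.eq_symm_apply, hσ, Equiv.apply_symm_apply]
    simp [this]
  · filter_upwards [hT.isOpen.mem_nhds hu, hyp, hb] with v hv hvy hvb
    obtain ⟨A, hA, h1, h2, h3⟩ := hL v hv
    exact ⟨A, hA, h1, h2, h3 _ _ (hT.ne_point_of_isBranch hv hvy hvb) hvy hvb⟩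

end IsTransformation

/-! ### From parametrised curves back to functions of `t` -/

/-- The squares of the shifted parameters. -/
noncomputable def thetaSq (θ : Sing → ℂ) (k : Sing) : ℂ :=
  (θ k - if k = .infty then 1 else 0) ^ 2

lemma rhsSq_thetaSq (θ : Sing → ℂ) (t y p : ℂ) :
    rhsSq (thetaSq θ) t y p =
      rhs ((θ .infty - 1) ^ 2 / 2) (-(θ .zero) ^ 2 / 2) ((θ .one) ^ 2 / 2)
          ((1 - (θ .t) ^ 2) / 2) t y p := by
  simp [rhsSq, thetaSq]

lemma thetaSq_newTheta (θ : Sing → ℂ) (i : Sing → Sing) :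
    thetaSq (newTheta θ i) = fun k => thetaSq θ (i k) / 4 := by
  funext k
  simp only [thetaSq, newTheta, add_sub_cancel_left]
  split_ifs with h
  · rw [h]
    ring
  · ring

lemma solvesAt_id_iff {θ : Sing → ℂ} {y : ℂ → ℂ} {t : ℂ} :
    SolvesAt (thetaSq θ) id y t ↔ deriv (deriv y) t =
      rhs ((θ .infty - 1) ^ 2 / 2) (-(θ .zero) ^ 2 / 2) ((θ .one) ^ 2 / 2)
          ((1 - (θ .t) ^ 2) / 2) t (y t) (deriv y t) := by
  have : deriv (id : ℂ → ℂ) = fun _ => 1 := by funext; simp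
  rw [SolvesAt, defect, ← rhsSq_thetaSq, this]
  simp [sub_eq_zero]

/-- By the chain rule the terms with `T''` cancel, and the defect of `(T, y ∘ T)` is T'³ times that
of `y` itself. -/
lemma solvesAt_id_of_comp {e : Sing → ℂ} {T y : ℂ → ℂ} {x : ℂ} (hT : AnalyticAt ℂ T x)
    (hd : deriv T x ≠ 0) (hy : AnalyticAt ℂ y (T x)) (h : SolvesAt e T (y ∘ T) x) :
    SolvesAt e id y (T x) := by
  have hT' := hT.differentiableAt.hasDerivAt
  have hT2 := hT.deriv.differentiableAt.hasDerivAt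
  obtain ⟨d1, d2⟩ : deriv (y ∘ T) x = deriv y (T x) * deriv T x ∧ deriv (deriv (y ∘ T)) x =
      deriv (deriv y) (T x) * deriv T x * deriv T x + deriv y (T x) * deriv (deriv T) x := by
    apply deriv_deriv_eq (f' := fun u => deriv y (T u) * deriv T u)
    · filter_upwards [eventually_hasDerivAt hT,
        hT.continuousAt.eventually (eventually_hasDerivAt hy)] with u hu hyu
      exact hyu.comp u hu
    · exact (hy.deriv.differentiableAt.hasDerivAt.comp x hT').mul hT2
  have hid : deriv (id : ℂ → ℂ) = fun _ => 1 := by funext; simp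
  rw [SolvesAt, defect, d1, d2, mul_div_cancel_right₀ _ hd] at h
  rw [SolvesAt, defect, hid]
  simp only [deriv_const, id, mul_zero, sub_zero, one_pow, one_mul, div_one, mul_one]
  apply mul_left_cancel₀ (pow_ne_zero 3 hd)
  simp only [Function.comp_apply] at h
  linear_combination h

lemma eventually_nhdsNE_of_codiscreteWithin {U : Set ℂ} (hU : IsOpen U) {p : ℂ → Prop}
    (h : ∀ᶠ t in codiscreteWithin U, p t) {x : ℂ} (hx : x ∈ U) :
    ∀ᶠ t in 𝓝[≠] x, p t := by
  have := mem_codiscreteWithin_iff_forall_mem_nhdsNE.1 h x hx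
  filter_upwards [this, nhdsWithin_le_nhds (hU.mem_nhds hx)] with t ht htU
  exact ht.resolve_right (fun h => h htU)

lemma eventually_codiscreteWithin_of_nhdsNE {U : Set ℂ} {p : ℂ → Prop}
    (h : ∀ x ∈ U, ∀ᶠ t in 𝓝[≠] x, p t) : ∀ᶠ t in codiscreteWithin U, p t :=
  mem_codiscreteWithin_iff_forall_mem_nhdsNE.2 fun x hx =>
    (h x hx).mono fun _ ht => Or.inl ht

/-- `T` is a local homeomorphism at `x`, so punctured neighbourhoods of `T x` are covered by images
of punctured neighbourhoods of `x`. -/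
lemma eventually_nhdsNE_image {T : ℂ → ℂ} {x : ℂ} (hT : AnalyticAt ℂ T x) (hd : deriv T x ≠ 0)
    {p : ℂ → Prop} (h : ∀ᶠ u in 𝓝[≠] x, p (T u)) : ∀ᶠ t in 𝓝[≠] (T x), p t := by
  rw [eventually_nhdsWithin_iff] at h ⊢
  have hmap := hT.hasStrictDerivAt.map_nhds_eq hd
  rw [← hmap, eventually_map]
  filter_upwards [h] with u hu hne
  exact hu fun h' => hne (by rw [h']; rfl)

/-- Near any `u` it is enough to treat points `v ≠ u`. There the functions are analytic, the
hypotheses hold on a full neighbourhood, and the exceptional value `1/2` of the normalised variable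
is avoided. -/
theorem solvesParametrically_of_isTransformation {U : Set ℂ} {P : Finset Sing}
    {z : ℂ → OnePoint ℂ → OnePoint ℂ} {m : ℂ → Matrix.GeneralLinearGroup (Fin 2) ℂ}
    {τ : ℂ → OnePoint ℂ} {T : ℂ → ℂ} {i : Sing → Sing} {θ₀ : Sing → ℂ} {y₀ Y : ℂ → ℂ}
    (hT : IsTransformation U P z m τ T i) (hθ : Admissible P θ₀) (hy₀ : IsSolution θ₀ U y₀)
    (hY : IsBranch U z m y₀ Y) : SolvesParametrically (newTheta θ₀ i) U T Y := by
  obtain ⟨hU, -, -, hm, hsol⟩ := hy₀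
  obtain ⟨hYm, hYb⟩ := hY
  refine ⟨fun t ht => hT.deriv_ne_zero ht, fun W hWU hW hinj y hy => ?_⟩
  have hyT : ∀ u ∈ W, y ∘ T =ᶠ[𝓝 u] Y := fun u hu => by
    filter_upwards [hW.mem_nhds hu] with v hv using hy v hv
  refine ⟨?_, ?_, ?_, ?_, ?_⟩
  · rw [isOpen_iff_mem_nhds]
    rintro _ ⟨u, hu, rfl⟩
    rw [← (hT.analyticAt (hWU hu)).hasStrictDerivAt.map_nhds_eq (hT.deriv_ne_zero (hWU hu))]
    exact image_mem_map (hW.mem_nhds hu)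
  · rintro ⟨u, hu, h⟩
    exact (hT.smul_tau u (hWU hu)).2.1 h
  · rintro ⟨u, hu, h⟩
    exact (hT.smul_tau u (hWU hu)).2.2 h
  · rintro _ ⟨u, hu, rfl⟩
    rw [← meromorphicAt_comp_iff_of_deriv_ne_zero (hT.analyticAt (hWU hu))
      (hT.deriv_ne_zero (hWU hu))]
    exact (hYm u (hWU hu)).congr ((hyT u hu).symm.filter_mono nhdsWithin_le_nhds)
  · apply eventually_codiscreteWithin_of_nhdsNE
    rintro _ ⟨u, hu, rfl⟩
    apply eventually_nhdsNE_image (hT.analyticAt (hWU hu)) (hT.deriv_ne_zero (hWU hu))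
    obtain ⟨ρ, σ, μ, μ', ν, ν', M, M', hμ, hμ', hσ, h0, h1, hL⟩ := hT.exists_landen (hWU hu)
    -- `μ` has nonzero derivative, so it takes the value `1/2` only at isolated points.
    have hgen : ∀ᶠ v in 𝓝[≠] u, μ v ≠ 1 / 2 :=
      ((hμ.analyticAt u (hT.ne_zero (hWU hu)) (hT.ne_one (hWU hu))).differentiableAt.hasDerivAt
        ).eventually_ne (hμ.deriv_ne u (hT.ne_zero (hWU hu)) (hT.ne_one (hWU hu)))
    have hs := eventually_nhdsNE_of_codiscreteWithin hU hsol (hWU hu)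
    have hb := eventually_nhdsNE_of_codiscreteWithin hU hYb (hWU hu)
    filter_upwards [nhdsWithin_le_nhds (hW.mem_nhds hu), (hYm u (hWU hu)).eventually_analyticAt,
      hgen, eventually_eventually_nhdsWithin.2 hs, eventually_eventually_nhdsWithin.2 hb,
      self_mem_nhdsWithin] with v hvW hvY hvμ hvs hvb hvu
    -- Since `v ≠ u`, the punctured set is a neighbourhood of `v`, so second derivatives at `v` can
    -- be compared.
    rw [isOpen_compl_singleton.nhdsWithin_eq hvu] at hvs hvb
    have hvU := hWU hvW
    have hyp : ∀ᶠ v' in 𝓝 v, ∀ k : Sing, (y₀ v' : OnePoint ℂ) ≠ k.point v' :=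
      hvs.mono fun v' h => forall_ne_point_iff.2 ⟨h.2.1, h.2.2.1, h.2.2.2.1⟩
    obtain ⟨hva, -, -, -, hvd⟩ := hvs.self_of_nhds
    have he : ∀ k ∈ P, thetaSq θ₀ k = 0 := by
      intro k hk
      rw [thetaSq, hθ k hk]
      simp
    have key := hT.solvesAt he hμ hμ' hσ h0 h1 hL hvU hva hvY hyp hvb
      (fun h => hvμ (by linear_combination h / 2)) (solvesAt_id_iff.2 hvd)
    have hyv : AnalyticAt ℂ y (T v) := by
      rw [← analyticAt_comp_iff_of_deriv_ne_zero (hT.analyticAt hvU) (hT.deriv_ne_zero hvU)]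
      exact hvY.congr (hyT v hvW).symm
    have hne := hT.ne_point_of_isBranch hvU hyp.self_of_nhds hvb.self_of_nhds
    rw [← hy v hvW, forall_ne_point_iff] at hne
    refine ⟨hyv, hne.1, hne.2.1, hne.2.2, ?_⟩
    rw [← solvesAt_id_iff, thetaSq_newTheta]
    apply solvesAt_id_of_comp (hT.analyticAt hvU) (hT.deriv_ne_zero hvU) hyv
    rw [SolvesAt] at key ⊢
    rwa [(hyT v hvW).deriv.deriv_eq, (hyT v hvW).deriv_eq, (hyT v hvW).eq_of_nhds]

/-! ### Existence, uniqueness and counting -/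

lemma preimage_smul_comp {z : OnePoint ℂ → OnePoint ℂ} (g : Matrix.GeneralLinearGroup (Fin 2) ℂ)
    (c : OnePoint ℂ) : (fun x => g • z x) ⁻¹' {c} = z ⁻¹' {g⁻¹ • c} := by
  ext x
  simp [eq_inv_smul_iff]

lemma ncard_sphereSq_preimage_zero : (sphereSq ⁻¹' {((0 : ℂ) : OnePoint ℂ)}).ncard = 1 := by
  rw [Set.ncard_eq_one]
  refine ⟨((0 : ℂ) : OnePoint ℂ), ?_⟩
  ext x
  cases x <;> simp [OnePoint.infty_ne_coe]

lemma ncard_sphereSq_preimage_infty :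
    (sphereSq ⁻¹' {(OnePoint.infty : OnePoint ℂ)}).ncard = 1 := by
  rw [Set.ncard_eq_one]
  refine ⟨OnePoint.infty, ?_⟩
  ext x
  cases x <;> simp

lemma ncard_sphereSq_preimage {c : OnePoint ℂ} (h0 : c ≠ ((0 : ℂ) : OnePoint ℂ))
    (h1 : c ≠ OnePoint.infty) : (sphereSq ⁻¹' {c}).ncard = 2 := by
  cases c with
  | infty => exact absurd rfl h1
  | coe c =>
    obtain ⟨s, hs⟩ := IsAlgClosed.exists_pow_nat_eq c two_pos
    have hs0 : s ≠ 0 := by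
      rintro rfl
      apply h0
      rw [← hs]
      simp
    have : sphereSq ⁻¹' {(c : OnePoint ℂ)} = {(s : OnePoint ℂ), ((-s : ℂ) : OnePoint ℂ)} := by
      ext x
      cases x with
      | infty => simp [OnePoint.infty_ne_coe]
      | coe x => simp [← hs, sq_eq_sq_iff_eq_or_eq_neg]
    rw [this, Set.ncard_pair]
    intro h
    rw [OnePoint.coe_eq_coe, self_eq_neg] at h
    exact hs0 h

lemma exists_isQuadraticBelyi {t : ℂ} (h0 : t ≠ 0) (h1 : t ≠ 1) {P : Finset Sing}
    (hP : P.card = 2) : ∃ z, IsQuadraticBelyi t P z := by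
  obtain ⟨p₁, p₂, hp, hP'⟩ := Finset.card_eq_two.1 hP
  have hinj := point_injective h0 h1
  obtain ⟨g, hg0, hg1⟩ := exists_smul_zero_infty_eq (hinj.ne hp)
  refine ⟨fun x => g • sphereSq x, isQuadratic_sphereSq.smul g, hP, ?_, ?_⟩
  · intro k hk
    simp only [hP', Finset.mem_insert, Finset.mem_singleton] at hk
    rw [preimage_smul_comp]
    rcases hk with rfl | rfl
    · rw [← hg0, inv_smul_smul, ncard_sphereSq_preimage_zero]
    · rw [← hg1, inv_smul_smul, ncard_sphereSq_preimage_infty]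
  · intro k hk
    simp only [hP', Finset.mem_insert, Finset.mem_singleton, not_or] at hk
    rw [preimage_smul_comp]
    apply ncard_sphereSq_preimage
    · rw [Ne, inv_smul_eq_iff, hg0]
      exact hinj.ne hk.1
    · rw [Ne, inv_smul_eq_iff, hg1]
      exact hinj.ne hk.2

/-- Both functions factor through the squaring map with the same outer transformation `g`, fixed by
the critical values; only the inner ones differ. -/
lemma IsQuadraticBelyi.exists_comp_eq {t : ℂ} (h0 : t ≠ 0) (h1 : t ≠ 1) {P : Finset Sing}
    {z z' : OnePoint ℂ → OnePoint ℂ} (hz : IsQuadraticBelyi t P z)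
    (hz' : IsQuadraticBelyi t P z') :
    ∃ g : Matrix.GeneralLinearGroup (Fin 2) ℂ, z' = fun x => z (g • x) := by
  obtain ⟨hq, hP, hc, -⟩ := hz
  obtain ⟨hq', -, hc', -⟩ := hz'
  obtain ⟨p₁, p₂, hp, rfl⟩ := Finset.card_eq_two.1 hP
  obtain ⟨g, hg0, hg1⟩ := exists_smul_zero_infty_eq ((point_injective h0 h1).ne hp)
  obtain ⟨h, rfl⟩ := hq.exists_eq_smul_sphereSq (g := g) (by rw [hg0]; exact hc p₁ (by simp))
    (by rw [hg1]; exact hc p₂ (by simp))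
  obtain ⟨h', rfl⟩ := hq'.exists_eq_smul_sphereSq (g := g) (by rw [hg0]; exact hc' p₁ (by simp))
    (by rw [hg1]; exact hc' p₂ (by simp))
  exact ⟨h⁻¹ * h', by simp [mul_smul]⟩

lemma IsQuadraticBelyi.ncard_nonApparent {t : ℂ} (h0 : t ≠ 0) (h1 : t ≠ 1) {P : Finset Sing}
    {z : OnePoint ℂ → OnePoint ℂ} (hz : IsQuadraticBelyi t P z) :
    (nonApparent t P z).ncard = 4 := by
  obtain ⟨-, hP, -, hc⟩ := hz
  have hPc : Pᶜ.card = 2 := by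
    rw [Finset.card_compl, hP]
    rfl
  obtain ⟨j, k, hjk, hPjk⟩ := Finset.card_eq_two.1 hPc
  have hmem : ∀ l, l ∉ P ↔ l = j ∨ l = k := by
    intro l
    rw [← Finset.mem_compl, hPjk]
    simp
  have : nonApparent t P z = z ⁻¹' {j.point t} ∪ z ⁻¹' {k.point t} := by
    ext x
    simp [nonApparent, hmem]
  have c1 := hc j ((hmem j).2 (Or.inl rfl))
  have c2 := hc k ((hmem k).2 (Or.inr rfl))
  rw [this, Set.ncard_union_eq _ (Set.finite_of_ncard_ne_zero (by simp [c1]))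
    (Set.finite_of_ncard_ne_zero (by simp [c2])), c1, c2]
  rw [Set.disjoint_left]
  intro x hx hx'
  exact hjk (point_injective h0 h1 (hx.symm.trans hx'))

lemma range_point (t : ℂ) : Set.range (Sing.point t) =
    {((0 : ℂ) : OnePoint ℂ), ((1 : ℂ) : OnePoint ℂ), OnePoint.infty, (t : OnePoint ℂ)} := by
  ext x
  simp only [Set.mem_range, Set.mem_insert_iff, Set.mem_singleton_iff]
  constructor
  · rintro ⟨_ | _ | _ | _, rfl⟩ <;> simp [Sing.point]
  · rintro (rfl | rfl | rfl | rfl)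
    exacts [⟨.zero, rfl⟩, ⟨.one, rfl⟩, ⟨.infty, rfl⟩, ⟨.t, rfl⟩]

/-- A fractional linear transformation which moves three of four given points to `0`, `1`, `∞`
moves the fourth to some `t ≠ 0, 1`. -/
lemma exists_image_eq_range_point {N : Set (OnePoint ℂ)} (hN : N.ncard = 4) {x y w : OnePoint ℂ}
    (hx : x ∈ N) (hy : y ∈ N) (hw : w ∈ N) {g : Matrix.GeneralLinearGroup (Fin 2) ℂ}
    (h0 : g • x = ((0 : ℂ) : OnePoint ℂ)) (h1 : g • y = ((1 : ℂ) : OnePoint ℂ))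
    (h2 : g • w = OnePoint.infty) :
    ∃ t : ℂ, t ≠ 0 ∧ t ≠ 1 ∧ (fun x => g • x) '' N = Set.range (Sing.point t) := by
  have hfin : N.Finite := Set.finite_of_ncard_ne_zero (by simp [hN])
  have hxy : x ≠ y := by
    rintro rfl
    rw [h0, OnePoint.coe_eq_coe] at h1
    exact zero_ne_one h1
  have hxw : x ≠ w := by
    rintro rfl
    rw [h0] at h2
    exact OnePoint.coe_ne_infty _ h2
  have hyw : y ≠ w := by
    rintro rfl
    rw [h1] at h2
    exact OnePoint.coe_ne_infty _ h2
  have h3 : ({x, y, w} : Set (OnePoint ℂ)).ncard = 3 := by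
    rw [Set.ncard_eq_three]
    exact ⟨x, y, w, hxy, hxw, hyw, rfl⟩
  obtain ⟨n, hnN, hn⟩ := Set.exists_mem_notMem_of_ncard_lt_ncard
    (s := ({x, y, w} : Set (OnePoint ℂ))) (t := N) (by rw [h3, hN]; simp) (Set.toFinite _)
  simp only [Set.mem_insert_iff, Set.mem_singleton_iff, not_or] at hn
  have hset : ({x, y, w, n} : Set (OnePoint ℂ)) = N := by
    apply Set.eq_of_subset_of_ncard_le _ _ hfin
    · rintro _ (rfl | rfl | rfl | rfl) <;> assumption
    · have : ({x, y, w, n} : Set (OnePoint ℂ)) = insert n {x, y, w} := by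
        ext
        simp only [Set.mem_insert_iff, Set.mem_singleton_iff]
        tauto
      rw [hN, this, Set.ncard_insert_of_notMem (by simpa using hn), h3]
  obtain ⟨t, ht⟩ : ∃ t : ℂ, g • n = (t : OnePoint ℂ) := by
    have : g • n ≠ OnePoint.infty := by
      rw [← h2]
      exact (MulAction.injective g).ne hn.2.2
    cases hgn : g • n with
    | infty => exact absurd hgn this
    | coe t => exact ⟨t, rfl⟩
  refine ⟨t, ?_, ?_, ?_⟩
  · rintro rfl
    exact hn.1 (MulAction.injective g (ht.trans h0.symm))
  · rintro rfl
    exact hn.2.1 (MulAction.injective g (ht.trans h1.symm))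
  · rw [← hset, range_point]
    simp only [Set.image_insert_eq, Set.image_singleton, h0, h1, h2, ht]

/-- Recording the preimages of `0`, `1`, `∞` is a bijection onto the injections of three letters
into `N`: any three points can be prescribed, they determine the transformation, and the fourth
point then automatically goes to an allowed `t`. -/
lemma ncard_normalizing {N : Set (OnePoint ℂ)} (hN : N.ncard = 4) :
    {f : OnePoint ℂ → OnePoint ℂ |
      (∃ g : Matrix.GeneralLinearGroup (Fin 2) ℂ, f = fun x => g • x) ∧
        ∃ t : ℂ, t ≠ 0 ∧ t ≠ 1 ∧ f '' N = Set.range (Sing.point t)}.ncard = 24 := by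
  have hfin : N.Finite := Set.finite_of_ncard_ne_zero (by simp [hN])
  have : Fintype N := hfin.fintype
  have hcard : Nat.card (Fin 3 ↪ N) = 24 := by
    rw [Nat.card_eq_fintype_card, Fintype.card_embedding_eq, ← Nat.card_eq_fintype_card,
      Nat.card_coe_set_eq, hN]
    rfl
  have hex : ∀ e : Fin 3 ↪ N, ∃ g : Matrix.GeneralLinearGroup (Fin 2) ℂ,
      g • (e 0 : OnePoint ℂ) = ((0 : ℂ) : OnePoint ℂ) ∧
      g • (e 1 : OnePoint ℂ) = ((1 : ℂ) : OnePoint ℂ) ∧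
      g • (e 2 : OnePoint ℂ) = OnePoint.infty := by
    intro e
    have hne : ∀ a b : Fin 3, a ≠ b → (e a : OnePoint ℂ) ≠ e b := fun a b hab h =>
      hab (e.injective (Subtype.ext h))
    exact exists_smul_eq_zero_one_infty (hne 0 1 (by decide)) (hne 0 2 (by decide))
      (hne 1 2 (by decide))
  choose G hG using hex
  rw [← Nat.card_coe_set_eq, ← hcard]
  symm
  refine Nat.card_eq_of_bijective (fun e => ⟨fun x => G e • x, ⟨G e, rfl⟩,
    exists_image_eq_range_point hN (e 0).2 (e 1).2 (e 2).2 (hG e).1 (hG e).2.1 (hG e).2.2⟩) ⟨?_, ?_⟩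
  · intro e e' h
    have h' : ∀ x : OnePoint ℂ, G e • x = G e' • x := fun x => congrFun (Subtype.ext_iff.1 h) x
    obtain ⟨a0, a1, a2⟩ := hG e
    obtain ⟨b0, b1, b2⟩ := hG e'
    rw [h'] at a0 a1 a2
    ext k
    fin_cases k
    · exact MulAction.injective _ (a0.trans b0.symm)
    · exact MulAction.injective _ (a1.trans b1.symm)
    · exact MulAction.injective _ (a2.trans b2.symm)
  · rintro ⟨_, ⟨g, rfl⟩, t, ht0, ht1, ht⟩
    have hpre : ∀ k : Sing, ∃ x : N, g • (x : OnePoint ℂ) = k.point t := by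
      intro k
      have : k.point t ∈ (fun x => g • x) '' N := by
        rw [ht]
        exact ⟨k, rfl⟩
      obtain ⟨x, hx, hxk⟩ := this
      exact ⟨⟨x, hx⟩, hxk⟩
    choose X hX using hpre
    have hXinj : Function.Injective X := by
      intro j k hjk
      apply point_injective ht0 ht1
      rw [← hX, ← hX, hjk]
    have hinj : Function.Injective ![Sing.zero, Sing.one, Sing.infty] := by decide
    refine ⟨⟨fun k => X (![Sing.zero, Sing.one, Sing.infty] k), hXinj.comp hinj⟩, ?_⟩
    apply Subtype.ext
    funext w
    obtain ⟨a0, a1, a2⟩ :=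
      hG ⟨fun k => X (![Sing.zero, Sing.one, Sing.infty] k), hXinj.comp hinj⟩
    exact smul_eq_smul_of_eq a0 (hX .zero) a1 (hX .one) a2 (hX .infty) w

lemma IsQuadraticBelyi.ncard_isNormalizing {t : ℂ} (h0 : t ≠ 0) (h1 : t ≠ 1) {P : Finset Sing}
    {z : OnePoint ℂ → OnePoint ℂ} (hz : IsQuadraticBelyi t P z) :
    {f | IsNormalizing t P z f}.ncard = 24 :=
  ncard_normalizing (hz.ncard_nonApparent h0 h1)

lemma ncard_pairs {t : ℂ} (h0 : t ≠ 0) (h1 : t ≠ 1) {Z : Finset Sing → OnePoint ℂ → OnePoint ℂ}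
    (hZ : ∀ P : Finset Sing, P.card = 2 → IsQuadraticBelyi t P (Z P)) :
    {a : Finset Sing × (OnePoint ℂ → OnePoint ℂ) |
      a.1.card = 2 ∧ IsNormalizing t a.1 (Z a.1) a.2}.ncard = 144 := by
  let E : {a : Finset Sing × (OnePoint ℂ → OnePoint ℂ) |
      a.1.card = 2 ∧ IsNormalizing t a.1 (Z a.1) a.2} ≃
      (Σ P : {P : Finset Sing // P.card = 2}, {f | IsNormalizing t P.1 (Z P.1) f}) :=
    { toFun := fun a => ⟨⟨a.1.1, a.2.1⟩, ⟨a.1.2, a.2.2⟩⟩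
      invFun := fun b => ⟨⟨b.1.1, b.2.1⟩, ⟨b.1.2, b.2.2⟩⟩
      left_inv := fun _ => rfl
      right_inv := fun _ => rfl }
  have hcard : ∀ P : {P : Finset Sing // P.card = 2},
      Nat.card {f | IsNormalizing t P.1 (Z P.1) f} = 24 := fun P => by
    rw [Nat.card_coe_set_eq]
    exact (hZ P.1 P.2).ncard_isNormalizing h0 h1
  have : ∀ P : {P : Finset Sing // P.card = 2},
      Finite {f | IsNormalizing t P.1 (Z P.1) f} := fun P =>
    Nat.finite_of_card_ne_zero (by rw [hcard]; simp)
  rw [← Nat.card_coe_set_eq, Nat.card_congr E, Nat.card_sigma]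
  simp only [hcard, Finset.sum_const, Finset.card_univ, smul_eq_mul]
  have : Fintype.card {P : Finset Sing // P.card = 2} = 6 := by decide
  rw [this]

/-! ### Manin's transformation -/

/-- The quadratic Belyi function `x² / (4 (x - 1))`. -/
noncomputable abbrev maninMap : OnePoint ℂ → OnePoint ℂ :=
  quadraticMap (Polynomial.X ^ 2) (4 * (Polynomial.X - 1))

lemma maninMap_infty : maninMap OnePoint.infty = OnePoint.infty := by
  change (if _ = 0 then _ else _) = _
  rw [if_pos]
  rw [show (4 : ℂ[X]) = C 4 from rfl, coeff_C_mul]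
  simp [coeff_X, coeff_one]

lemma maninMap_coe (x : ℂ) : maninMap x =
    if x - 1 = 0 then OnePoint.infty else ((x ^ 2 / (4 * (x - 1)) : ℂ) : OnePoint ℂ) := by
  change (if _ = 0 then _ else _) = _
  simp

lemma maninMap_coe_eq_infty_iff {x : ℂ} : maninMap x = OnePoint.infty ↔ x = 1 := by
  rw [maninMap_coe]
  split_ifs with h
  · simpa [sub_eq_zero] using h
  · simpa [sub_eq_zero] using h

lemma maninMap_coe_eq_coe_iff {x c : ℂ} :
    maninMap x = (c : OnePoint ℂ) ↔ x ^ 2 = 4 * c * (x - 1) := by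
  rw [maninMap_coe]
  split_ifs with h
  · have hx := sub_eq_zero.1 h
    simp [hx, OnePoint.infty_ne_coe]
  · rw [OnePoint.coe_eq_coe, div_eq_iff (by simp [h])]
    constructor <;> intro h' <;> linear_combination h'

lemma isQuadratic_maninMap : IsQuadratic maninMap := by
  refine ⟨_, _, ?_, max_natDegree_eq_two_iff.2 ⟨by simp, ?_, Or.inl (by simp)⟩, rfl⟩
  -- Bézout relation X² - (X + 1)(X - 1) = 1.
  · refine ⟨1, -C (1 / 4) * (X + 1), ?_⟩
    have : (C (1 / 4) * 4 : ℂ[X]) = 1 := by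
      rw [show (4 : ℂ[X]) = C 4 from rfl, ← C_mul]
      norm_num
    linear_combination (-(X + 1) * (X - 1)) * this
  · rw [show (4 : ℂ[X]) = C 4 from rfl]
    exact (natDegree_C_mul_le _ _).trans ((natDegree_X_sub_C_le (1 : ℂ)).trans one_le_two)

section Manin

variable {t r : ℂ}

lemma maninMap_preimage_t (hr : r ^ 2 = t ^ 2 - t) : maninMap ⁻¹' {(t : OnePoint ℂ)} =
    {((2 * (t + r) : ℂ) : OnePoint ℂ), ((2 * (t - r) : ℂ) : OnePoint ℂ)} := by
  ext x
  cases x with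
  | infty => simp [maninMap_infty, OnePoint.infty_ne_coe]
  | coe x =>
    simp only [Set.mem_preimage, Set.mem_singleton_iff, Set.mem_insert_iff,
      maninMap_coe_eq_coe_iff, OnePoint.coe_eq_coe]
    have : x ^ 2 = 4 * t * (x - 1) ↔ (x - 2 * (t + r)) * (x - 2 * (t - r)) = 0 := by
      constructor <;> intro h
      · linear_combination h - 4 * hr
      · linear_combination h + 4 * hr
    rw [this, mul_eq_zero, sub_eq_zero, sub_eq_zero]

lemma maninMap_preimage_infty : maninMap ⁻¹' {(OnePoint.infty : OnePoint ℂ)} =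
    {((1 : ℂ) : OnePoint ℂ), OnePoint.infty} := by
  ext x
  cases x with
  | infty => simp [maninMap_infty]
  | coe x => simp [maninMap_coe_eq_infty_iff]

lemma ne_zero_of_sq_eq (h0 : t ≠ 0) (h1 : t ≠ 1) (hr : r ^ 2 = t ^ 2 - t) : r ≠ 0 := by
  rintro rfl
  apply mul_ne_zero h0 (sub_ne_zero.2 h1)
  linear_combination -hr

lemma isQuadraticBelyi_maninMap (h0 : t ≠ 0) (h1 : t ≠ 1) (hr : r ^ 2 = t ^ 2 - t) :
    IsQuadraticBelyi t {Sing.zero, Sing.one} maninMap := by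
  refine ⟨isQuadratic_maninMap, by decide, ?_, ?_⟩
  · intro k hk
    simp only [Finset.mem_insert, Finset.mem_singleton] at hk
    rw [Set.ncard_eq_one]
    rcases hk with rfl | rfl
    · refine ⟨((0 : ℂ) : OnePoint ℂ), ?_⟩
      ext x
      cases x with
      | infty => simp [maninMap_infty, Sing.point, OnePoint.infty_ne_coe]
      | coe x =>
        simp [Sing.point, maninMap_coe_eq_coe_iff]
    · refine ⟨((2 : ℂ) : OnePoint ℂ), ?_⟩
      ext x
      cases x with
      | infty => simp [maninMap_infty, Sing.point, OnePoint.infty_ne_coe]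
      | coe x =>
        simp only [Sing.point, Set.mem_preimage, Set.mem_singleton_iff, maninMap_coe_eq_coe_iff,
          OnePoint.coe_eq_coe]
        have : x ^ 2 = 4 * 1 * (x - 1) ↔ (x - 2) ^ 2 = 0 := by
          constructor <;> intro h <;> linear_combination h
        rw [this, sq_eq_zero_iff, sub_eq_zero]
  · intro k hk
    have hr0 := ne_zero_of_sq_eq h0 h1 hr
    cases k with
    | zero => simp at hk
    | one => simp at hk
    | t =>
      change (maninMap ⁻¹' {(t : OnePoint ℂ)}).ncard = 2
      rw [maninMap_preimage_t hr, Set.ncard_pair]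
      rw [Ne, OnePoint.coe_eq_coe]
      intro h
      apply hr0
      linear_combination h / 4
    | infty =>
      change (maninMap ⁻¹' {(OnePoint.infty : OnePoint ℂ)}).ncard = 2
      rw [maninMap_preimage_infty, Set.ncard_pair (OnePoint.coe_ne_infty _)]

lemma nonApparent_maninMap (hr : r ^ 2 = t ^ 2 - t) :
    nonApparent t {Sing.zero, Sing.one} maninMap =
      {((2 * (t - r) : ℂ) : OnePoint ℂ), ((1 : ℂ) : OnePoint ℂ), OnePoint.infty,
        ((2 * (t + r) : ℂ) : OnePoint ℂ)} := by
  have : nonApparent t {Sing.zero, Sing.one} maninMap =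
      maninMap ⁻¹' {(t : OnePoint ℂ)} ∪ maninMap ⁻¹' {(OnePoint.infty : OnePoint ℂ)} := by
    ext x
    constructor
    · rintro ⟨k, hk, hx⟩
      cases k with
      | zero => simp at hk
      | one => simp at hk
      | t => exact Or.inl hx
      | infty => exact Or.inr hx
    · rintro (hx | hx)
      · exact ⟨.t, by simp, hx⟩
      · exact ⟨.infty, by simp, hx⟩
  rw [this, maninMap_preimage_t hr, maninMap_preimage_infty]
  ext x
  simp only [Set.mem_union, Set.mem_insert_iff, Set.mem_singleton_iff]
  tauto

/-- Its product with the conjugate 1 - 2t - 2r is (1 - 2t)² - 4r² = 1. -/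
lemma manin_denom_ne_zero (hr : r ^ 2 = t ^ 2 - t) : 1 - 2 * t + 2 * r ≠ 0 := by
  intro h
  have : (1 : ℂ) = 0 := by linear_combination (1 - 2 * t - 2 * r) * h + 4 * hr
  exact one_ne_zero this

/-- The fractional linear transformation in Manin's transformation. -/
noncomputable def maninMobius (hr : r ^ 2 = t ^ 2 - t) : Matrix.GeneralLinearGroup (Fin 2) ℂ :=
  mobius 1 (-2 * t + 2 * r) 0 (1 - 2 * t + 2 * r) (by simpa using manin_denom_ne_zero hr)

lemma maninMobius_smul_coe (hr : r ^ 2 = t ^ 2 - t) (x : ℂ) :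
    maninMobius hr • (x : OnePoint ℂ) =
      (((x - 2 * t + 2 * r) / (1 - 2 * t + 2 * r) : ℂ) : OnePoint ℂ) := by
  rw [maninMobius, mobius_smul_coe_of_ne_zero _ (by simpa using manin_denom_ne_zero hr)]
  congr 2 <;> ring

lemma maninMobius_smul_infty (hr : r ^ 2 = t ^ 2 - t) :
    maninMobius hr • (OnePoint.infty : OnePoint ℂ) = OnePoint.infty :=
  OnePoint.smul_infty_eq_self_iff.2 rfl

lemma maninMobius_smul_root (hr : r ^ 2 = t ^ 2 - t) :
    maninMobius hr • ((2 * (t - r) : ℂ) : OnePoint ℂ) = ((0 : ℂ) : OnePoint ℂ) := by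
  rw [maninMobius_smul_coe, OnePoint.coe_eq_coe, div_eq_zero_iff]
  left
  ring

lemma maninMobius_smul_one (hr : r ^ 2 = t ^ 2 - t) :
    maninMobius hr • ((1 : ℂ) : OnePoint ℂ) = ((1 : ℂ) : OnePoint ℂ) := by
  rw [maninMobius_smul_coe, OnePoint.coe_eq_coe, div_self (manin_denom_ne_zero hr)]

lemma maninMobius_smul_tau (hr : r ^ 2 = t ^ 2 - t) :
    maninMobius hr • ((2 * (t + r) : ℂ) : OnePoint ℂ) =
      ((4 * r / (1 - 2 * t + 2 * r) : ℂ) : OnePoint ℂ) := by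
  rw [maninMobius_smul_coe, OnePoint.coe_eq_coe]
  congr 1
  ring

lemma manin_t_ne_zero (h0 : t ≠ 0) (h1 : t ≠ 1) (hr : r ^ 2 = t ^ 2 - t) :
    4 * r / (1 - 2 * t + 2 * r) ≠ 0 :=
  div_ne_zero (mul_ne_zero (by norm_num) (ne_zero_of_sq_eq h0 h1 hr)) (manin_denom_ne_zero hr)

lemma manin_t_ne_one (hr : r ^ 2 = t ^ 2 - t) : 4 * r / (1 - 2 * t + 2 * r) ≠ 1 := by
  rw [Ne, div_eq_one_iff_eq (manin_denom_ne_zero hr)]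
  intro h
  -- The value `1` would force the conjugate factor 1 - 2t - 2r to vanish, which the same product
  -- excludes.
  have : (1 : ℂ) = 0 := by linear_combination (-1 + 2 * t - 2 * r) * h + 4 * hr
  exact one_ne_zero this

end Manin

theorem isTransformation_manin {U : Set ℂ} {r : ℂ → ℂ} {m : ℂ → Matrix.GeneralLinearGroup (Fin 2) ℂ}
    (hU : IsOpen U) (hU0 : (0 : ℂ) ∉ U) (hU1 : (1 : ℂ) ∉ U) (hrd : DifferentiableOn ℂ r U)
    (hr : ∀ t ∈ U, r t ^ 2 = t ^ 2 - t) (hm : ∀ t (ht : t ∈ U), m t = maninMobius (hr t ht)) :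
    IsTransformation U {Sing.zero, Sing.one} (fun _ => maninMap) m
      (fun t => ((2 * (t + r t) : ℂ) : OnePoint ℂ))
      (fun t => 4 * r t / (1 - 2 * t + 2 * r t)) maninLabel := by
  have hne0 : ∀ t ∈ U, t ≠ 0 := fun t ht h => hU0 (h ▸ ht)
  have hne1 : ∀ t ∈ U, t ≠ 1 := fun t ht h => hU1 (h ▸ ht)
  refine ⟨hU, hU0, hU1, fun t ht => isQuadraticBelyi_maninMap (hne0 t ht) (hne1 t ht) (hr t ht),
    fun t ht => ⟨⟨m t, rfl⟩, 4 * r t / (1 - 2 * t + 2 * r t),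
      manin_t_ne_zero (hne0 t ht) (hne1 t ht) (hr t ht), manin_t_ne_one (hr t ht), ?_⟩,
    fun t ht => ?_, ?_, fun t ht => ⟨?_, manin_t_ne_zero (hne0 t ht) (hne1 t ht) (hr t ht),
      manin_t_ne_one (hr t ht)⟩, fun t ht k => ?_⟩
  · rw [nonApparent_maninMap (hr t ht), range_point, hm t ht]
    simp only [Set.image_insert_eq, Set.image_singleton, maninMobius_smul_root,
      maninMobius_smul_one, maninMobius_smul_infty, maninMobius_smul_tau]
  · rw [nonApparent_maninMap (hr t ht)]
    simp
  · apply DifferentiableOn.div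
    · fun_prop
    · fun_prop
    · exact fun t ht => manin_denom_ne_zero (hr t ht)
  · rw [hm t ht, maninMobius_smul_tau]
  · have hroot : ((2 * (t - r t) : ℂ) : OnePoint ℂ) ∈ maninMap ⁻¹' {(t : OnePoint ℂ)} := by
      rw [maninMap_preimage_t (hr t ht)]
      simp
    have htau : ((2 * (t + r t) : ℂ) : OnePoint ℂ) ∈ maninMap ⁻¹' {(t : OnePoint ℂ)} := by
      rw [maninMap_preimage_t (hr t ht)]
      simp
    rw [hm t ht]
    cases k with
    | zero =>
      change maninMap ((maninMobius (hr t ht))⁻¹ • ((0 : ℂ) : OnePoint ℂ)) = (t : OnePoint ℂ)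
      rw [← maninMobius_smul_root (hr t ht), inv_smul_smul]
      exact hroot
    | one =>
      change maninMap ((maninMobius (hr t ht))⁻¹ • ((1 : ℂ) : OnePoint ℂ)) = OnePoint.infty
      rw [inv_smul_eq_iff.2 (maninMobius_smul_one (hr t ht)).symm]
      exact maninMap_coe_eq_infty_iff.2 rfl
    | t =>
      change maninMap ((maninMobius (hr t ht))⁻¹ • ((4 * r t / (1 - 2 * t + 2 * r t) : ℂ) :
        OnePoint ℂ)) = (t : OnePoint ℂ)
      rw [← maninMobius_smul_tau (hr t ht), inv_smul_smul]
      exact htau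
    | infty =>
      change maninMap ((maninMobius (hr t ht))⁻¹ • (OnePoint.infty : OnePoint ℂ)) = OnePoint.infty
      rw [inv_smul_eq_iff.2 (maninMobius_smul_infty (hr t ht)).symm, maninMap_infty]

theorem isBranch_manin {U : Set ℂ} {r : ℂ → ℂ} {m : ℂ → Matrix.GeneralLinearGroup (Fin 2) ℂ}
    (hU : IsOpen U) (hrd : DifferentiableOn ℂ r U)
    (hr : ∀ t ∈ U, r t ^ 2 = t ^ 2 - t) (hm : ∀ t (ht : t ∈ U), m t = maninMobius (hr t ht))
    {y₀ ρ : ℂ → ℂ} (hy : MeromorphicOn y₀ U) (hρ : MeromorphicOn ρ U)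
    (h : ∀ᶠ t in codiscreteWithin U, ρ t ^ 2 = y₀ t ^ 2 - y₀ t) :
    IsBranch U (fun _ => maninMap) m y₀
      (fun t => 2 * (y₀ t + ρ t - t + r t) / (1 - 2 * t + 2 * r t)) := by
  have hid : MeromorphicOn (fun t : ℂ => t) U := MeromorphicOn.id
  have hrm : MeromorphicOn r U := fun t ht =>
    (hrd.analyticAt (hU.mem_nhds ht)).meromorphicAt
  constructor
  · intro t ht
    have := hy t ht
    have := hρ t ht
    have := hrm t ht
    have := hid t ht
    fun_prop
  · filter_upwards [h, self_mem_codiscreteWithin U] with t ht htU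
    -- A root of x² = 4y₀(x - 1), by the quadratic formula with ρ² = y₀² - y₀.
    refine ⟨((2 * (y₀ t + ρ t) : ℂ) : OnePoint ℂ), ?_, ?_⟩
    · rw [maninMap_coe_eq_coe_iff]
      linear_combination 4 * ht
    · rw [hm t htU, maninMobius_smul_coe, OnePoint.coe_eq_coe]
      congr 1
      ring

lemma newTheta_maninLabel (θ : Sing → ℂ) : newTheta θ maninLabel = maninTheta θ := by
  funext k
  cases k <;> simp [newTheta, maninLabel, maninTheta]

end PainleveSix

/-! ### Assembly of the statement -/

open PainleveSix in
theorem proposition5 :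
    -- the transformation of solutions
    (∀ (U : Set ℂ) (P : Finset Sing) (z : ℂ → OnePoint ℂ → OnePoint ℂ)
        (m : ℂ → Matrix.GeneralLinearGroup (Fin 2) ℂ) (τ : ℂ → OnePoint ℂ) (T : ℂ → ℂ)
        (i : Sing → Sing) (θ₀ : Sing → ℂ) (y₀ Y : ℂ → ℂ),
        IsTransformation U P z m τ T i → Admissible P θ₀ → IsSolution θ₀ U y₀ →
        IsBranch U z m y₀ Y →
        SolvesParametrically (newTheta θ₀ i) U T Y) ∧
    -- the six quadratic Belyi functions, one for each pair of critical values,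
    -- up to a fractional linear change of the independent variable
    ((Finset.univ.filter fun P : Finset Sing => P.card = 2).card = 6 ∧
      ∀ t₀ : ℂ, t₀ ≠ 0 → t₀ ≠ 1 → ∀ P : Finset Sing, P.card = 2 →
        (∃ z, IsQuadraticBelyi t₀ P z) ∧
        ∀ z z', IsQuadraticBelyi t₀ P z → IsQuadraticBelyi t₀ P z' →
          ∃ g : Matrix.GeneralLinearGroup (Fin 2) ℂ, z' = fun x => z (g • x)) ∧
    -- the 24 fractional linear transformations for each of them, and the total number 144
    (∀ t₀ : ℂ, t₀ ≠ 0 → t₀ ≠ 1 →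
        (∀ P z, IsQuadraticBelyi t₀ P z → {f | IsNormalizing t₀ P z f}.ncard = 24) ∧
        ∀ Z : Finset Sing → OnePoint ℂ → OnePoint ℂ,
          (∀ P : Finset Sing, P.card = 2 → IsQuadraticBelyi t₀ P (Z P)) →
          {a : Finset Sing × (OnePoint ℂ → OnePoint ℂ) |
            a.1.card = 2 ∧ IsNormalizing t₀ a.1 (Z a.1) a.2}.ncard = 144) ∧
    -- Manin's transformation is among them
    (∀ (U : Set ℂ) (r : ℂ → ℂ), IsOpen U → (0 : ℂ) ∉ U → (1 : ℂ) ∉ U →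
        DifferentiableOn ℂ r U → (∀ t₀ ∈ U, r t₀ ^ 2 = t₀ ^ 2 - t₀) →
        ∃ m : ℂ → Matrix.GeneralLinearGroup (Fin 2) ℂ,
          (∀ t₀ ∈ U, (m t₀ : Matrix (Fin 2) (Fin 2) ℂ) =
            !![1, -2 * t₀ + 2 * r t₀; 0, 1 - 2 * t₀ + 2 * r t₀]) ∧
          IsTransformation U {Sing.zero, Sing.one}
            (fun _ => quadraticMap (Polynomial.X ^ 2) (4 * (Polynomial.X - 1))) m
            (fun t₀ => ((2 * (t₀ + r t₀) : ℂ) : OnePoint ℂ))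
            (fun t₀ => 4 * r t₀ / (1 - 2 * t₀ + 2 * r t₀)) maninLabel ∧
          ∀ (θ₀ : Sing → ℂ) (y₀ ρ : ℂ → ℂ), θ₀ .zero = 0 → θ₀ .one = 0 →
            IsSolution θ₀ U y₀ → MeromorphicOn ρ U →
            (∀ᶠ t₀ in Filter.codiscreteWithin U, ρ t₀ ^ 2 = y₀ t₀ ^ 2 - y₀ t₀) →
            IsBranch U
              (fun _ => quadraticMap (Polynomial.X ^ 2) (4 * (Polynomial.X - 1))) m y₀
              (fun t₀ => 2 * (y₀ t₀ + ρ t₀ - t₀ + r t₀) / (1 - 2 * t₀ + 2 * r t₀)) ∧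
            SolvesParametrically (maninTheta θ₀) U
              (fun t₀ => 4 * r t₀ / (1 - 2 * t₀ + 2 * r t₀))
              (fun t₀ => 2 * (y₀ t₀ + ρ t₀ - t₀ + r t₀) / (1 - 2 * t₀ + 2 * r t₀))) := by

  refine ⟨fun U P z m τ T i θ₀ y₀ Y hT hθ hy hY =>
      solvesParametrically_of_isTransformation hT hθ hy hY,
    ⟨by decide, fun t h0 h1 P hP => ⟨exists_isQuadraticBelyi h0 h1 hP,
      fun z z' hz hz' => hz.exists_comp_eq h0 h1 hz'⟩⟩,
    fun t h0 h1 => ⟨fun P z hz => hz.ncard_isNormalizing h0 h1, fun Z hZ => ncard_pairs h0 h1 hZ⟩,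
    fun U r hU hU0 hU1 hrd hr => ?_⟩
  classical
  -- Invertibility of the matrix relies on r² = t² - t, known only on `U`; the value elsewhere is
  -- irrelevant.
  let m : ℂ → Matrix.GeneralLinearGroup (Fin 2) ℂ := fun t =>
    if ht : t ∈ U then maninMobius (hr t ht) else 1
  have hm : ∀ t (ht : t ∈ U), m t = maninMobius (hr t ht) := fun t ht => dif_pos ht
  have hT := isTransformation_manin hU hU0 hU1 hrd hr hm
  refine ⟨m, fun t ht => ?_, hT, fun θ₀ y₀ ρ h0 h1 hy hρ hρy => ?_⟩
  · rw [hm t ht]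
    rfl
  · have hb := isBranch_manin hU hrd hr hm hy.2.2.2.1 hρ hρy
    refine ⟨hb, ?_⟩
    rw [← newTheta_maninLabel]
    refine solvesParametrically_of_isTransformation hT (fun k hk => ?_) hy hb
    simp only [Finset.mem_insert, Finset.mem_singleton] at hk
    rcases hk with rfl | rfl <;> simp [h0, h1]
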